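/- **Theorem 1.3.** Let $n\in\mathbb N=\{1,2,\dots\}$, $m\in\mathbb N_0$ and $-1<a\le m$; all functions are real-valued. *Notation.* Write $\mathbb R^{n+1}_+=\mathbb R^n\times(0,\infty)\ni(x,t)$. For $k\in\mathbb N$, $W_a^{k,1}(\mathbb R^{n+1}_+)$ is the space of all $u\in W^{k,1}_{\mathrm{loc}}(\mathbb R^{n+1}_+)$ with $$\|u\|_{W_a^{k,1}(\mathbb R^{n+1}_+)}:=\int_{\mathbb R^{n+1}_+}t^a|u(x,t)|\,dx\,dt+\sum_{j=1}^{k}\int_{\mathbb R^{n+1}_+}t^a|\nabla^{j}u(x,t)|\,dx\,dt<\infty ,$$ where $|\nabla^j u|$ is the Euclidean norm of the tensor of all $j$-th order weak partial derivatives of $u$ in $(x,t)$. For $0<\sigma\le 1$ let $$|g|_{B^{\sigma,1}(\mathbb R^n)}:=\int_{\mathbb R^n}\|\Delta_h^{\lfloor\sigma\rfloor+1}g\|_{L^1(\mathbb R^n)}\,\frac{dh}{|h|^{n+\sigma}},\qquad \Delta_hg(x)=g(x+h)-g(x),\quad \Delta_h^{k+1}g=\Delta_h^k(\Delta_hg).$$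 For $s>0$ let $\ell$ be the largest integer with $\ell<s$. Then $B^{s,1}(\mathbb R^n)$ is the space of all $f\in W^{\ell,1}(\mathbb R^n)$ (with $W^{0,1}=L^1$) such that $$\|f\|_{B^{s,1}(\mathbb R^n)}:=\sum_{|\alpha|\le\ell}\|\partial^\alpha f\|_{L^1(\mathbb R^n)}+\sum_{|\alpha|=\ell}|\partial^\alpha f|_{B^{s-\ell,1}(\mathbb R^n)}<\infty .$$ $\operatorname{Tr}(F)=f$ means that $F(\cdot,t)\to f$ in $L^1(\mathbb R^n)$ as $t\to0^+$ (as an essential limit, that is, disregarding a null set of $t$). *Statement.* 1. If $a<m$, there is a constant $C$ depending only on $n$, $m$ and $a$ such that for every $f\in B^{m-a,1}(\mathbb R^n)$ there exists $F\in W_a^{m+1,1}(\mathbb R^{n+1}_+)$ with $\operatorname{Tr}(F)=f$ and $$\|F\|_{W_a^{m+1,1}(\mathbb R^{n+1}_+)}\le C\,\|f\|_{B^{m-a,1}(\mathbb R^n)} .$$ 2. If $a=m$, there is a constant $C$ depending only on $n$ and $m$ such that for every $f\in L^1(\mathbb R^n)$ there exists $F\in W_m^{m+1,1}(\mathbb R^{n+1}_+)$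 with $\operatorname{Tr}(F)=f$ and $$\|F\|_{W_m^{m+1,1}(\mathbb R^{n+1}_+)}\le C\,\|f\|_{L^1(\mathbb R^n)} .$$ -/

import Mathlib

open MeasureTheory Filter Topology Set
open scoped ENNReal NNReal ContDiff

noncomputable section

namespace TraceExt

/-! ### Weak derivatives -/

/-- `g` is the weak derivative `∂_{v 0} ⋯ ∂_{v (k-1)} u` of `u` in the open set `Ω`: both functions are
in `L¹_loc(Ω)` and `∫_Ω u ∂_{v 0} ⋯ ∂_{v (k-1)} φ = (-1)^k ∫_Ω g φ` for every `φ ∈ C_c^∞(Ω)`. -/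
def HasWeakDeriv {V : Type*} [NormedAddCommGroup V] [NormedSpace ℝ V] [MeasureSpace V]
    (Ω : Set V) {k : ℕ} (v : Fin k → V) (u g : V → ℝ) : Prop :=
  LocallyIntegrableOn u Ω volume ∧ LocallyIntegrableOn g Ω volume ∧
    ∀ φ : V → ℝ, ContDiff ℝ ∞ φ → HasCompactSupport φ → tsupport φ ⊆ Ω →
      ∫ x in Ω, u x * iteratedFDeriv ℝ k φ x v = (-1) ^ k * ∫ x in Ω, g x * φ x

open Classical in
/-- The weak derivative `∂_{v 0} ⋯ ∂_{v (k-1)} u` in `Ω` (a representative of it; it is unique almost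
everywhere in `Ω`). The value is `0` if there is none, but all spaces below require existence. -/
def weakDeriv {V : Type*} [NormedAddCommGroup V] [NormedSpace ℝ V] [MeasureSpace V]
    (Ω : Set V) {k : ℕ} (v : Fin k → V) (u : V → ℝ) : V → ℝ :=
  if h : ∃ g, HasWeakDeriv Ω v u g then h.choose else 0

/-- `u ∈ W^{k,1}_loc(Ω)`: all weak derivatives of orders `0, …, k` along the coordinate directions
`e` exist in `L¹_loc(Ω)`. -/
def MemSobolevLoc {V : Type*} [NormedAddCommGroup V] [NormedSpace ℝ V] [MeasureSpace V]
    {ι : Type*} (Ω : Set V) (e : ι → V) (k : ℕ) (u : V → ℝ) : Prop :=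
  ∀ j ≤ k, ∀ w : Fin j → ι, ∃ g, HasWeakDeriv Ω (fun i => e (w i)) u g

/-- The Euclidean length `|∇^k u|` of the tensor of all `k`-th order weak partial derivatives
`∂_{w 0} ⋯ ∂_{w (k-1)} u`. -/
def gradNorm {V : Type*} [NormedAddCommGroup V] [NormedSpace ℝ V] [MeasureSpace V]
    {ι : Type*} [Fintype ι] (Ω : Set V) (e : ι → V) (k : ℕ) (u : V → ℝ) (x : V) : ℝ :=
  √(∑ w : Fin k → ι, (weakDeriv Ω (fun i => e (w i)) u x) ^ 2)

/-! ### Sobolev and Besov spaces on `ℝⁿ` -/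

/-- The coordinate directions of `ℝⁿ`. -/
def dir (n : ℕ) (i : Fin n) : EuclideanSpace ℝ (Fin n) := EuclideanSpace.single i 1

open Classical in
/-- The multi-indices `α ∈ ℕ₀ⁿ` with `|α| = k`, each written as the nondecreasing word
`0 ⋯ 0 1 ⋯ 1 ⋯` in which the letter `i` occurs `α i` times. -/
def multiIndices (n k : ℕ) : Finset (Fin k → Fin n) := Finset.univ.filter Monotone

/-- The weak derivative `∂^α f` on `ℝⁿ`, for a multi-index written as a word. -/
def partialDeriv {n k : ℕ} (α : Fin k → Fin n) (f : EuclideanSpace ℝ (Fin n) → ℝ) :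
    EuclideanSpace ℝ (Fin n) → ℝ :=
  weakDeriv univ (fun i => dir n (α i)) f

/-- The norm `∑_{|α| ≤ k} ‖∂^α f‖_{L¹}` of `W^{k,1}(ℝⁿ)`. -/
def sobolevNorm (n k : ℕ) (f : EuclideanSpace ℝ (Fin n) → ℝ) : ℝ≥0∞ :=
  ∑ j ∈ Finset.range (k + 1), ∑ α ∈ multiIndices n j, ∫⁻ x, ‖partialDeriv α f x‖ₑ

/-- The seminorm `|g|_{B^{σ,1}} = ∫ ‖Δ_h^{⌊σ⌋+1} g‖_{L¹} dh / |h|^{n+σ}`, used for `0 < σ ≤ 1`. -/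
def besovSeminorm (n : ℕ) (σ : ℝ) (g : EuclideanSpace ℝ (Fin n) → ℝ) : ℝ≥0∞ :=
  ∫⁻ h, (∫⁻ x, ‖(fwdDiff h)^[⌊σ⌋₊ + 1] g x‖ₑ) / ENNReal.ofReal (‖h‖ ^ ((n : ℝ) + σ))

/-- The largest integer `ℓ` with `ℓ < s`, for `s > 0`. -/
def besovOrder (s : ℝ) : ℕ := ⌈s⌉₊ - 1

/-- The norm `‖f‖_{W^{ℓ,1}} + ∑_{|α| = ℓ} |∂^α f|_{B^{s-ℓ,1}}` of `B^{s,1}(ℝⁿ)`, `s > 0`, with `ℓ` the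
largest integer smaller than `s`. For `s ≤ 1` this is `‖f‖_{L¹} + |f|_{B^{s,1}}`. -/
def besovNorm (n : ℕ) (s : ℝ) (f : EuclideanSpace ℝ (Fin n) → ℝ) : ℝ≥0∞ :=
  sobolevNorm n (besovOrder s) f +
    ∑ α ∈ multiIndices n (besovOrder s), besovSeminorm n (s - besovOrder s) (partialDeriv α f)

/-- `f ∈ B^{s,1}(ℝⁿ)`. -/
def MemBesov (n : ℕ) (s : ℝ) (f : EuclideanSpace ℝ (Fin n) → ℝ) : Prop :=
  MemSobolevLoc univ (dir n) (besovOrder s) f ∧ besovNorm n s f < ⊤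

/-! ### Weighted Sobolev spaces on the half-space, and traces -/

/-- The half-space `ℝ^{n+1}_+ = ℝⁿ × (0, ∞)`. -/
def halfSpace (n : ℕ) : Set (EuclideanSpace ℝ (Fin n) × ℝ) := {p | 0 < p.2}

/-- The coordinate directions `x_1, …, x_n, t` of `ℝⁿ × ℝ`. -/
def halfDir (n : ℕ) : Fin n ⊕ Unit → EuclideanSpace ℝ (Fin n) × ℝ :=
  Sum.elim (fun i => (dir n i, 0)) (fun _ => (0, 1))

/-- The seminorm `∫_{ℝ^{n+1}_+} t^a |∇^j u| dx dt`. -/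
def weightedSeminorm (n : ℕ) (a : ℝ) (j : ℕ) (u : EuclideanSpace ℝ (Fin n) × ℝ → ℝ) : ℝ≥0∞ :=
  ∫⁻ p in halfSpace n, ENNReal.ofReal (p.2 ^ a * gradNorm (halfSpace n) (halfDir n) j u p)

/-- The norm `∫ t^a |u| dx dt + ∑_{j=1}^{k} ∫ t^a |∇^j u| dx dt` of `W_a^{k,1}(ℝ^{n+1}_+)`. -/
def weightedNorm (n : ℕ) (a : ℝ) (k : ℕ) (u : EuclideanSpace ℝ (Fin n) × ℝ → ℝ) : ℝ≥0∞ :=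
  (∫⁻ p in halfSpace n, ENNReal.ofReal (p.2 ^ a * |u p|)) +
    ∑ j ∈ Finset.Icc 1 k, weightedSeminorm n a j u

/-- `u ∈ W_a^{k,1}(ℝ^{n+1}_+)`. -/
def MemWeighted (n : ℕ) (a : ℝ) (k : ℕ) (u : EuclideanSpace ℝ (Fin n) × ℝ → ℝ) : Prop :=
  MemSobolevLoc (halfSpace n) (halfDir n) k u ∧ weightedNorm n a k u < ⊤

/-- `Tr F = f`: the slices `F(·, t)` converge to `f` in `L¹(ℝⁿ)` as `t → 0⁺`. Since `F` is only
determined almost everywhere, the limit is an essential one (a null set of `t` is disregarded), so that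
the notion depends only on the classes of `F` and `f`, and `f` is determined almost everywhere by `F`.
If `F` is continuous up to `t = 0`, it forces `f = F(·, 0)` almost everywhere; every
`F ∈ W_a^{k,1}(ℝ^{n+1}_+)` with `1 ≤ k` and `a ≤ k - 1` has a trace in this sense. -/
def IsTrace (n : ℕ) (F : EuclideanSpace ℝ (Fin n) × ℝ → ℝ) (f : EuclideanSpace ℝ (Fin n) → ℝ) :
    Prop :=
  Tendsto (fun t : ℝ => ∫⁻ x, ‖F (x, t) - f x‖ₑ) (𝓝[>] (0 : ℝ) ⊓ ae volume) (𝓝 0)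

end TraceExt

end

/-!
The extension of `f` has the form `F (x, t) = ∑ k, η (t / τ k) * u k x`, where `f = ∑ k, u k` in `L¹` with
smooth `u k`, the heights `τ k ≤ 1` tend to `0`, and `η` is a cutoff equal to `1` on `t ≤ 1` and to `0`
on `t ≥ 2`. In the open half-space the sum is locally finite, so `F` is smooth and its weak
derivatives are the classical ones; as `t → 0⁺` every layer is eventually uncut, so the slices tend to `f`.
A term in which `i` of the `j` derivatives fall on the cutoff contributes at most a multiple of
`τ^{a+1-i} ‖D^{j-i} u‖_{L¹}` to the weighted norm, because `∫₀^{2τ} t^a dt` is of order `τ^{a+1}`. For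
`j ≤ m + 1` and `τ ≤ 1` this is at most `τ^{l-s} ‖D^l u‖_{L¹}` with `l = j - i` and `s = m - a`. Hence
everything reduces to a decomposition of `f` for which `∑ k, ∑_{l ≤ m+1} (τ k)^{l-s} ‖D^l u k‖_{L¹}`
(`pieceCost`) is controlled by the norm of `f`: this is `exists_extension_of_pieces`.

* For `s = 0`, take smooth approximations of `f` in `L¹` that converge geometrically, let `u k` be their
  differences, and choose `τ k` so small that the terms with derivatives are negligible
  (`exists_pieces_of_integrable`). The heights depend on `f`, so the extension is not linear.
* For `s > 0`, take `τ k = 2^{-k}` and a kernel `K` such that `f - f * K_τ` is, up to a sign, the average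
  of the differences `Δ_{τ h}^M f` against a mollifier in `h` (`sub_conv_diffKernel`). The partial sums
  are `f * K_τ * K_{τ/2}`. As convolutions commute, `u (k + 1)` is the convolution with `K_{τ/2}` of the
  difference of `f * K_{τ/4}` and `f * K_τ`: the outer kernel takes all the derivatives, and the inner
  difference is bounded by the modulus `‖Δ_h^M f‖_{L¹}`. Summing a geometric series gives
  `∫ ‖Δ_h^M f‖_{L¹} |h|^{-n-s} dh` (`exists_pieces_of_modulus`).
* With `M = ℓ + ⌊s - ℓ⌋ + 1`, the first `ℓ` differences are traded for `|h|^ℓ` times the weak derivatives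
  of order `ℓ` (`modulus_le_of_hasWeakDeriv`), which turns that integral into the Besov seminorm of
  order `s - ℓ` (`lintegral_modulus_le_besovNorm`).
-/

set_option linter.unusedSectionVars false

namespace TraceExt

/-! ### Iterated derivatives of smooth functions -/

section IteratedDerivatives

variable {V W : Type*} [NormedAddCommGroup V] [NormedSpace ℝ V]
  [NormedAddCommGroup W] [NormedSpace ℝ W]

/-- The last direction of an iterated derivative is the one that is differentiated first. -/
theorem iteratedFDeriv_succ_apply_last {f : V → W} (hf : ContDiff ℝ ∞ f) {k : ℕ}
    (v : Fin (k + 1) → V) (x : V) :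
    iteratedFDeriv ℝ (k + 1) f x v =
      iteratedFDeriv ℝ k (fun y => fderiv ℝ f y (v (Fin.last k))) x (Fin.init v) := by
  have h : ContDiff ℝ k (fderiv ℝ f) := hf.fderiv_right (by exact_mod_cast le_top)
  rw [iteratedFDeriv_succ_apply_right, iteratedFDeriv_clm_apply_const_apply h le_rfl]

/-- The first direction of an iterated derivative is the one that is differentiated last. -/
theorem iteratedFDeriv_succ_apply_first {f : V → W} (hf : ContDiff ℝ ∞ f) {k : ℕ}
    (v : Fin (k + 1) → V) (x : V) :
    iteratedFDeriv ℝ (k + 1) f x v =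
      fderiv ℝ (fun y => iteratedFDeriv ℝ k f y (Fin.tail v)) x (v 0) := by
  apply DifferentiableAt.iteratedFDeriv_succ_apply_left'
  exact (hf.contDiffAt).differentiableAt_iteratedFDeriv (by exact_mod_cast WithTop.coe_lt_top _)

theorem contDiff_fderiv_apply_const {f : V → W} (hf : ContDiff ℝ ∞ f) (v : V) :
    ContDiff ℝ ∞ (fun y => fderiv ℝ f y v) :=
  (hf.fderiv_right (m := ∞) (by simp)).clm_apply contDiff_const

theorem contDiff_iteratedFDeriv_apply_const {f : V → W} (hf : ContDiff ℝ ∞ f) {k : ℕ}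
    (v : Fin k → V) : ContDiff ℝ ∞ (fun y => iteratedFDeriv ℝ k f y v) := by
  have h : ContDiff ℝ ∞ (iteratedFDeriv ℝ k f) :=
    hf.iteratedFDeriv_right (m := ∞) (by exact_mod_cast le_top)
  exact (ContinuousMultilinearMap.apply ℝ (fun _ : Fin k => V) W v).contDiff.comp h

theorem tsupport_iteratedFDeriv_apply_subset (f : V → W) {k : ℕ} (v : Fin k → V) :
    tsupport (fun y => iteratedFDeriv ℝ k f y v) ⊆ tsupport f :=
  (closure_mono (Function.support_subset_iff'.2 fun x hx => by
    rw [Function.notMem_support.1 hx]; rfl)).trans (tsupport_iteratedFDeriv_subset (𝕜 := ℝ) k)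

theorem hasCompactSupport_iteratedFDeriv_apply {f : V → W} (hf : HasCompactSupport f) {k : ℕ}
    (v : Fin k → V) : HasCompactSupport (fun y => iteratedFDeriv ℝ k f y v) :=
  hf.of_isClosed_subset isClosed_closure (tsupport_iteratedFDeriv_apply_subset f v)

theorem iteratedFDeriv_comp_swap_castSucc_succ {f : V → W} (hf : ContDiff ℝ ∞ f) {k : ℕ}
    (i : Fin k) (v : Fin (k + 1) → V) (x : V) :
    iteratedFDeriv ℝ (k + 1) f x (v ∘ Equiv.swap i.castSucc i.succ) =
      iteratedFDeriv ℝ (k + 1) f x v := by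
  induction k generalizing f with
  | zero => exact i.elim0
  | succ k ih =>
    rcases Fin.eq_castSucc_or_eq_last i with ⟨i, rfl⟩ | rfl
    · rw [iteratedFDeriv_succ_apply_last hf, iteratedFDeriv_succ_apply_last hf v]
      have h1 : (v ∘ Equiv.swap i.castSucc.castSucc i.castSucc.succ) (Fin.last (k + 1)) =
          v (Fin.last (k + 1)) := by
        simp only [Function.comp_apply]
        rw [Equiv.swap_apply_of_ne_of_ne]
        · exact (Fin.castSucc_lt_last _).ne'
        · rw [Fin.succ_castSucc]
          exact (Fin.castSucc_lt_last _).ne'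
      have h2 : Fin.init (v ∘ Equiv.swap i.castSucc.castSucc i.castSucc.succ) =
          (Fin.init v) ∘ Equiv.swap i.castSucc i.succ := by
        funext j
        simp only [Fin.init, Function.comp_apply, Fin.succ_castSucc]
        rw [← (Fin.castSucc_injective _).map_swap]
      rw [h1, h2]
      exact ih (contDiff_fderiv_apply_const hf _) i (Fin.init v)
    · have key : ∀ w : Fin (k + 1 + 1) → V, iteratedFDeriv ℝ (k + 1 + 1) f x w =
          iteratedFDeriv ℝ k (fun y => fderiv ℝ (fun z => fderiv ℝ f z (w (Fin.last (k + 1)))) y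
            (w (Fin.last k).castSucc)) x (Fin.init (Fin.init w)) := by
        intro w
        rw [iteratedFDeriv_succ_apply_last hf,
          iteratedFDeriv_succ_apply_last (contDiff_fderiv_apply_const hf _)]
        rfl
      rw [key, key v]
      have h0 : Fin.init (Fin.init (v ∘ Equiv.swap (Fin.last k).castSucc (Fin.last k).succ)) =
          Fin.init (Fin.init v) := by
        funext j
        simp only [Fin.init, Function.comp_apply]
        rw [Equiv.swap_apply_of_ne_of_ne]
        · intro h
          exact (Fin.castSucc_lt_last j).ne (Fin.castSucc_injective _ h)
        · exact (Fin.castSucc_lt_last _).ne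
      have hsym : ∀ a b : V, (fun y => fderiv ℝ (fun z => fderiv ℝ f z a) y b) =
          fun y => fderiv ℝ (fun z => fderiv ℝ f z b) y a := by
        intro a b
        funext y
        have hd : DifferentiableAt ℝ (fderiv ℝ f) y :=
          ((hf.fderiv_right (m := ∞) (by simp)).differentiable (by simp)) y
        rw [fderiv_clm_apply hd (differentiableAt_const _),
          fderiv_clm_apply hd (differentiableAt_const _)]
        have := (hf.contDiffAt (x := y)).isSymmSndFDerivAt (by simpa using WithTop.coe_le_coe.2 (le_top : (2 : ℕ∞) ≤ ⊤))
        simpa using this.eq b a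
      rw [h0]
      simp only [Function.comp_apply, ← Fin.succ_last, Equiv.swap_apply_left,
        Equiv.swap_apply_right]
      rw [hsym]

/-- The iterated derivatives of a smooth function are symmetric. -/
theorem iteratedFDeriv_comp_perm {f : V → W} (hf : ContDiff ℝ ∞ f) {k : ℕ}
    (σ : Equiv.Perm (Fin k)) (v : Fin k → V) (x : V) :
    iteratedFDeriv ℝ k f x (v ∘ σ) = iteratedFDeriv ℝ k f x v := by
  cases k with
  | zero => congr 1; exact Subsingleton.elim _ _
  | succ k =>
    have hσ : σ ∈ Submonoid.closure
        (Set.range fun i : Fin k => Equiv.swap i.castSucc i.succ) := by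
      rw [Equiv.Perm.mclosure_swap_castSucc_succ]; trivial
    induction hσ using Submonoid.closure_induction generalizing v with
    | mem τ hτ =>
      obtain ⟨i, rfl⟩ := hτ
      exact iteratedFDeriv_comp_swap_castSucc_succ hf i v x
    | one => rfl
    | mul τ ρ _ _ hτ hρ =>
      rw [Equiv.Perm.coe_mul, ← Function.comp_assoc, hρ, hτ]

end IteratedDerivatives

/-! ### Weak derivatives -/

section WeakDerivatives

variable {V : Type*} [NormedAddCommGroup V] [NormedSpace ℝ V] [MeasureSpace V] [BorelSpace V]

theorem integrable_mul_of_tsupport_subset {Ω : Set V} {g φ : V → ℝ}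
    (hg : LocallyIntegrableOn g Ω volume) (hφ : Continuous φ) (hc : HasCompactSupport φ)
    (hs : tsupport φ ⊆ Ω) : Integrable (fun x => g x * φ x) volume := by
  have hK : IsCompact (tsupport φ) := hc
  have h : (tsupport φ).indicator (fun x => g x * φ x) = fun x => g x * φ x := by
    apply indicator_eq_self.2
    apply Function.support_subset_iff'.2
    intro x hx
    simp [image_eq_zero_of_notMem_tsupport hx]
  rw [← h, integrable_indicator_iff hK.measurableSet]
  exact (hg.integrableOn_compact_subset hs hK).mul_continuousOn hφ.continuousOn hK

theorem setIntegral_mul_eq_integral_mul {Ω : Set V} {g φ : V → ℝ} (hs : tsupport φ ⊆ Ω) :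
    ∫ x in Ω, g x * φ x = ∫ x, g x * φ x := by
  apply setIntegral_eq_integral_of_forall_compl_eq_zero
  intro x hx
  rw [image_eq_zero_of_notMem_tsupport (fun h => hx (hs h)), mul_zero]

theorem HasWeakDeriv.ae_eq [FiniteDimensional ℝ V] {Ω : Set V} (hΩ : IsOpen Ω) {k : ℕ}
    {v : Fin k → V} {u g g' : V → ℝ} (h : HasWeakDeriv Ω v u g) (h' : HasWeakDeriv Ω v u g') :
    g =ᵐ[volume.restrict Ω] g' := by
  rw [EventuallyEq, ae_restrict_iff' hΩ.measurableSet]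
  have := hΩ.ae_eq_zero_of_integral_contDiff_smul_eq_zero (h.2.1.sub h'.2.1) (fun φ h1 h2 h3 => by
    have e := (h.2.2 φ h1 h2 h3).symm.trans (h'.2.2 φ h1 h2 h3)
    have e := mul_left_cancel₀ (pow_ne_zero k (by norm_num)) e
    rw [setIntegral_mul_eq_integral_mul h3, setIntegral_mul_eq_integral_mul h3] at e
    simp only [smul_eq_mul, Pi.sub_apply, mul_comm (φ _), sub_mul]
    rw [integral_sub, e, sub_self]
    · exact integrable_mul_of_tsupport_subset h.2.1 h1.continuous h2 h3
    · exact integrable_mul_of_tsupport_subset h'.2.1 h1.continuous h2 h3)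
  filter_upwards [this] with x hx hxΩ
  exact sub_eq_zero.1 (hx hxΩ)

theorem hasWeakDeriv_weakDeriv {Ω : Set V} {k : ℕ} {v : Fin k → V} {u : V → ℝ}
    (h : ∃ g, HasWeakDeriv Ω v u g) : HasWeakDeriv Ω v u (weakDeriv Ω v u) := by
  rw [weakDeriv, dif_pos h]
  exact h.choose_spec

theorem HasWeakDeriv.weakDeriv_ae_eq [FiniteDimensional ℝ V] {Ω : Set V} (hΩ : IsOpen Ω) {k : ℕ}
    {v : Fin k → V} {u g : V → ℝ} (h : HasWeakDeriv Ω v u g) :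
    weakDeriv Ω v u =ᵐ[volume.restrict Ω] g :=
  (hasWeakDeriv_weakDeriv ⟨g, h⟩).ae_eq hΩ h

theorem hasWeakDeriv_zero {Ω : Set V} {u : V → ℝ} (h : LocallyIntegrableOn u Ω volume)
    (v : Fin 0 → V) : HasWeakDeriv Ω v u u :=
  ⟨h, h, fun φ _ _ _ => by simp⟩

theorem HasWeakDeriv.comp_perm {Ω : Set V} {k : ℕ} {v : Fin k → V} {u g : V → ℝ}
    (h : HasWeakDeriv Ω v u g) (σ : Equiv.Perm (Fin k)) : HasWeakDeriv Ω (v ∘ σ) u g := by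
  refine ⟨h.1, h.2.1, fun φ h1 h2 h3 => ?_⟩
  simp_rw [iteratedFDeriv_comp_perm h1]
  exact h.2.2 φ h1 h2 h3

/-- The weak derivative in the direction `(h, …, h)`, with `h = ∑ i, c i • e i`, from the weak
derivatives along the words in the `e i`. -/
theorem HasWeakDeriv.sum_smul {ι : Type*} [Fintype ι] {Ω : Set V} {k : ℕ} {u : V → ℝ}
    {e : ι → V} {g : (Fin k → ι) → V → ℝ} (hu : LocallyIntegrableOn u Ω volume)
    (h : ∀ w, HasWeakDeriv Ω (fun i => e (w i)) u (g w)) (c : ι → ℝ) :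
    HasWeakDeriv Ω (fun _ : Fin k => ∑ i, c i • e i) u (fun x => ∑ w, (∏ j, c (w j)) * g w x) := by
  classical
  refine ⟨hu, ?_, fun φ h1 h2 h3 => ?_⟩
  · have : (fun x => ∑ w, (∏ j, c (w j)) * g w x) = ∑ w, (∏ j, c (w j)) • g w := by
      ext x; simp
    rw [this]
    exact Finset.sum_induction _ (fun f => LocallyIntegrableOn f Ω volume)
      (fun _ _ => LocallyIntegrableOn.add) locallyIntegrableOn_zero
      (fun w _ => (h w).2.1.smul _)
  · have hD : ∀ x, iteratedFDeriv ℝ k φ x (fun _ => ∑ i, c i • e i) =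
        ∑ w : Fin k → ι, (∏ j, c (w j)) * iteratedFDeriv ℝ k φ x (fun i => e (w i)) := by
      intro x
      rw [ContinuousMultilinearMap.map_sum]
      refine Finset.sum_congr rfl fun w _ => ?_
      rw [ContinuousMultilinearMap.map_smul_univ, smul_eq_mul]
    have i1 : ∀ v : Fin k → V, Integrable (fun x => u x * iteratedFDeriv ℝ k φ x v)
        (volume.restrict Ω) := fun v =>
      (integrable_mul_of_tsupport_subset hu
        (contDiff_iteratedFDeriv_apply_const h1 v).continuous
        (hasCompactSupport_iteratedFDeriv_apply h2 v)
        ((tsupport_iteratedFDeriv_apply_subset φ v).trans h3)).restrict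
    have i2 : ∀ w, Integrable (fun x => g w x * φ x) (volume.restrict Ω) := fun w =>
      (integrable_mul_of_tsupport_subset (h w).2.1
        h1.continuous h2 h3).restrict
    simp_rw [hD, Finset.mul_sum, Finset.sum_mul, mul_left_comm (u _), mul_assoc]
    rw [integral_finsetSum _ fun w _ => (i1 _).const_mul _,
      integral_finsetSum _ fun w _ => (i2 _).const_mul _, Finset.mul_sum]
    refine Finset.sum_congr rfl fun w _ => ?_
    rw [integral_const_mul, integral_const_mul, (h w).2.2 φ h1 h2 h3]
    ring

variable [FiniteDimensional ℝ V] [(volume : Measure V).IsAddHaarMeasure]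

/-- Iterated integration by parts. -/
theorem integral_mul_iteratedFDeriv {u φ : V → ℝ} (hu : ContDiff ℝ ∞ u) (hφ : ContDiff ℝ ∞ φ)
    (hc : HasCompactSupport φ) {k : ℕ} (v : Fin k → V) :
    ∫ x, u x * iteratedFDeriv ℝ k φ x v = (-1) ^ k * ∫ x, iteratedFDeriv ℝ k u x v * φ x := by
  induction k generalizing u with
  | zero => simp
  | succ k ih =>
    have hψ := contDiff_iteratedFDeriv_apply_const hφ (Fin.tail v)
    have hψc : HasCompactSupport (fun y => iteratedFDeriv ℝ k φ y (Fin.tail v)) :=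
      hasCompactSupport_iteratedFDeriv_apply hc _
    have hψ' := contDiff_fderiv_apply_const hψ (v 0)
    have hψc' := hψc.fderiv_apply (𝕜 := ℝ) (v 0)
    have hu' := contDiff_fderiv_apply_const hu (v 0)
    -- By symmetry the direction `v 0` may be differentiated first, which puts the
    -- integration by parts in the order the induction hypothesis needs.
    have hrot : ∀ x, iteratedFDeriv ℝ (k + 1) u x v =
        iteratedFDeriv ℝ k (fun y => fderiv ℝ u y (v 0)) x (Fin.tail v) := by
      intro x
      rw [← iteratedFDeriv_comp_perm hu (finRotate (k + 1)),
        iteratedFDeriv_succ_apply_last hu]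
      congr 1
      · simp
      · funext j
        simp [Fin.init, Fin.tail]
    simp_rw [iteratedFDeriv_succ_apply_first hφ, hrot]
    rw [integral_mul_fderiv_eq_neg_fderiv_mul_of_integrable, ih hu', pow_succ]
    · ring
    · exact (hu'.continuous.mul hψ.continuous).integrable_of_hasCompactSupport hψc.mul_left
    · exact (hu.continuous.mul hψ'.continuous).integrable_of_hasCompactSupport hψc'.mul_left
    · exact (hu.continuous.mul hψ.continuous).integrable_of_hasCompactSupport hψc.mul_left
    · exact fun x _ => hu.differentiable (by simp) x
    · exact fun x _ => hψ.differentiable (by simp) x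

/-- A smooth function on an open set has its classical derivatives as weak derivatives. The hypothesis
says that near every compact subset of `Ω` the function agrees with one that is smooth on the whole
space. -/
theorem hasWeakDeriv_of_forall_compact {Ω : Set V} (hΩ : IsOpen Ω) {u : V → ℝ}
    (hu : ∀ K ⊆ Ω, IsCompact K → ∃ w : V → ℝ, ContDiff ℝ ∞ w ∧ ∀ x ∈ K, u =ᶠ[𝓝 x] w)
    {k : ℕ} (v : Fin k → V) :
    HasWeakDeriv Ω v u (fun x => iteratedFDeriv ℝ k u x v) := by
  have hl : ∀ g : V → ℝ, (∀ x ∈ Ω, ContinuousAt g x) → LocallyIntegrableOn g Ω volume :=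
    fun g hg => ContinuousOn.locallyIntegrableOn
      (fun x hx => (hg x hx).continuousWithinAt) hΩ.measurableSet
  refine ⟨hl _ fun x hx => ?_, hl _ fun x hx => ?_, fun φ h1 h2 h3 => ?_⟩
  · obtain ⟨w, hw, h⟩ := hu {x} (by simpa using hx) isCompact_singleton
    exact (hw.continuous.continuousAt).congr (h x rfl).symm
  · obtain ⟨w, hw, h⟩ := hu {x} (by simpa using hx) isCompact_singleton
    refine ((contDiff_iteratedFDeriv_apply_const hw v).continuous.continuousAt).congr ?_
    filter_upwards [(h x rfl).iteratedFDeriv ℝ k] with y hy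
    rw [hy]
  · obtain ⟨w, hw, h⟩ := hu (tsupport φ) h3 h2
    have h4 : tsupport (fun x => iteratedFDeriv ℝ k φ x v) ⊆ tsupport φ :=
      tsupport_iteratedFDeriv_apply_subset φ v
    rw [setIntegral_mul_eq_integral_mul (h4.trans h3), setIntegral_mul_eq_integral_mul h3]
    have := integral_mul_iteratedFDeriv hw h1 h2 v
    convert this using 2
    · funext x
      by_cases hx : x ∈ tsupport φ
      · rw [(h x hx).eq_of_nhds]
      · rw [image_eq_zero_of_notMem_tsupport (fun hx' => hx (h4 hx')), mul_zero, mul_zero]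
    · congr 1
      funext x
      by_cases hx : x ∈ tsupport φ
      · rw [((h x hx).iteratedFDeriv ℝ k).eq_of_nhds]
      · rw [image_eq_zero_of_notMem_tsupport hx, mul_zero, mul_zero]

end WeakDerivatives

/-! ### Extensions by layers -/

section Layers

/-- A smooth cutoff on the line, equal to `1` on `t ≤ 1` and to `0` on `2 ≤ t`. -/
noncomputable def cutoff (t : ℝ) : ℝ := Real.smoothTransition (2 - t)

theorem contDiff_cutoff : ContDiff ℝ ∞ cutoff :=
  Real.smoothTransition.contDiff.comp (contDiff_const.sub contDiff_id)

theorem cutoff_of_le_one {t : ℝ} (h : t ≤ 1) : cutoff t = 1 :=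
  Real.smoothTransition.one_of_one_le (by linarith)

theorem cutoff_of_two_le {t : ℝ} (h : 2 ≤ t) : cutoff t = 0 :=
  Real.smoothTransition.zero_of_nonpos (by linarith)

theorem abs_cutoff_sub_one_le (t : ℝ) : |cutoff t - 1| ≤ 1 := by
  have h1 := Real.smoothTransition.nonneg (2 - t)
  have h2 := Real.smoothTransition.le_one (2 - t)
  rw [abs_le, cutoff]
  constructor <;> linarith

theorem iteratedFDeriv_cutoff_of_two_lt {t : ℝ} (h : 2 < t) (i : ℕ) :
    iteratedFDeriv ℝ i cutoff t = 0 := by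
  have : cutoff =ᶠ[𝓝 t] fun _ => 0 := by
    filter_upwards [lt_mem_nhds h] with s hs using cutoff_of_two_le hs.le
  rw [(this.iteratedFDeriv ℝ i).eq_of_nhds]
  simp

theorem exists_norm_iteratedFDeriv_cutoff_le (J : ℕ) :
    ∃ C : ℝ, 0 ≤ C ∧ ∀ i ≤ J, ∀ t, 0 ≤ t → ‖iteratedFDeriv ℝ i cutoff t‖ ≤ C := by
  have h : ∀ i, ∃ C : ℝ, 0 ≤ C ∧ ∀ t, 0 ≤ t → ‖iteratedFDeriv ℝ i cutoff t‖ ≤ C := by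
    intro i
    obtain ⟨C, hC⟩ := (isCompact_Icc (a := (0 : ℝ)) (b := 2)).exists_bound_of_continuousOn
      (contDiff_cutoff.continuous_iteratedFDeriv (m := i)
        (by exact_mod_cast le_top)).continuousOn
    refine ⟨C, (norm_nonneg _).trans (hC 0 (by norm_num)), fun t ht => ?_⟩
    rcases le_or_gt t 2 with h2 | h2
    · exact hC t ⟨ht, h2⟩
    · rw [iteratedFDeriv_cutoff_of_two_lt h2, norm_zero]
      exact (norm_nonneg _).trans (hC 0 (by norm_num))
  choose C hC0 hC using h
  refine ⟨∑ i ∈ Finset.range (J + 1), C i, Finset.sum_nonneg fun i _ => hC0 i,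
    fun i hi t ht => (hC i t ht).trans ?_⟩
  exact Finset.single_le_sum (f := C) (fun i _ => hC0 i) (Finset.mem_range.2 (by omega))

variable {E : Type*} [NormedAddCommGroup E] [NormedSpace ℝ E]

/-- The function `u` on `E`, extended constantly in `t` and cut off at height `2 τ`. -/
noncomputable def layer (τ : ℝ) (u : E → ℝ) (p : E × ℝ) : ℝ := cutoff (p.2 / τ) * u p.1

theorem contDiff_layer (τ : ℝ) {u : E → ℝ} (hu : ContDiff ℝ ∞ u) : ContDiff ℝ ∞ (layer τ u) :=
  (contDiff_cutoff.comp (contDiff_snd.div_const τ)).mul (hu.comp contDiff_fst)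

theorem norm_iteratedFDeriv_comp_clm_le {G W : Type*} [NormedAddCommGroup G] [NormedSpace ℝ G]
    [NormedAddCommGroup W] [NormedSpace ℝ W] {f : E → W} (hf : ContDiff ℝ ∞ f) (L : G →L[ℝ] E)
    (i : ℕ) (x : G) :
    ‖iteratedFDeriv ℝ i (f ∘ L) x‖ ≤ ‖L‖ ^ i * ‖iteratedFDeriv ℝ i f (L x)‖ := by
  rw [L.iteratedFDeriv_comp_right hf x (by exact_mod_cast le_top)]
  refine (ContinuousMultilinearMap.norm_compContinuousLinearMap_le _ _).trans ?_
  simp [mul_comm]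

theorem norm_iteratedFDeriv_layer_le {τ : ℝ} (hτ : 0 < τ) {u : E → ℝ} (hu : ContDiff ℝ ∞ u)
    (j : ℕ) (p : E × ℝ) :
    ‖iteratedFDeriv ℝ j (layer τ u) p‖ ≤ ∑ i ∈ Finset.range (j + 1), (j.choose i : ℝ) *
      (τ⁻¹ ^ i * ‖iteratedFDeriv ℝ i cutoff (p.2 / τ)‖) *
        ‖iteratedFDeriv ℝ (j - i) u p.1‖ := by
  let L : E × ℝ →L[ℝ] ℝ := τ⁻¹ • ContinuousLinearMap.snd ℝ E ℝ
  have hL : ‖L‖ ≤ τ⁻¹ := by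
    refine (norm_smul_le τ⁻¹ (ContinuousLinearMap.snd ℝ E ℝ)).trans ?_
    rw [Real.norm_of_nonneg (inv_nonneg.2 hτ.le)]
    exact mul_le_of_le_one_right (inv_nonneg.2 hτ.le) (ContinuousLinearMap.norm_snd_le ..)
  have hLp : L p = p.2 / τ := by simp [L, div_eq_inv_mul]
  have e : layer τ u = fun p => (cutoff ∘ L) p * (u ∘ ContinuousLinearMap.fst ℝ E ℝ) p := by
    funext p; simp [layer, L, div_eq_inv_mul]
  rw [e]
  refine (norm_iteratedFDeriv_mul_le (N := ∞) (contDiff_cutoff.comp L.contDiff)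
    (hu.comp (ContinuousLinearMap.contDiff _)) p (by exact_mod_cast le_top)).trans ?_
  refine Finset.sum_le_sum fun i _ => ?_
  gcongr
  · refine (norm_iteratedFDeriv_comp_clm_le contDiff_cutoff L i p).trans ?_
    rw [hLp]
    gcongr
  · refine (norm_iteratedFDeriv_comp_clm_le hu (ContinuousLinearMap.fst ℝ E ℝ) _ p).trans ?_
    refine (mul_le_mul_of_nonneg_right (pow_le_one₀ (norm_nonneg _)
      (ContinuousLinearMap.norm_fst_le ..)) (norm_nonneg _)).trans ?_
    simp

variable [MeasureSpace E]

/-- The cost `∑_{l ≤ J} τ^{l-s} ‖D^l u‖_{L¹}` of `u` as a piece of a function of smoothness `s`, at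
scale `τ`. -/
noncomputable def pieceCost (s : ℝ) (J : ℕ) (τ : ℝ) (u : E → ℝ) : ℝ≥0∞ :=
  ∑ l ∈ Finset.range (J + 1), ENNReal.ofReal (τ ^ ((l : ℝ) - s)) * ∫⁻ x, ‖iteratedFDeriv ℝ l u x‖ₑ

theorem lintegral_Ioc_rpow {a : ℝ} (ha : -1 < a) {b : ℝ} (hb : 0 ≤ b) :
    ∫⁻ t in Ioc 0 b, ENNReal.ofReal (t ^ a) = ENNReal.ofReal (b ^ (a + 1) / (a + 1)) := by
  rw [← ofReal_integral_eq_lintegral_ofReal, ← intervalIntegral.integral_of_le hb,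
    integral_rpow (Or.inl ha), Real.zero_rpow (by linarith), sub_zero]
  · exact (intervalIntegrable_iff_integrableOn_Ioc_of_le hb).1
      (intervalIntegral.intervalIntegrable_rpow' ha)
  · filter_upwards [ae_restrict_mem measurableSet_Ioc] with t ht
    exact Real.rpow_nonneg ht.1.le _

variable [FiniteDimensional ℝ E] [BorelSpace E] [SFinite (volume : Measure E)]

theorem measurable_enorm_iteratedFDeriv {W : Type*} [NormedAddCommGroup W] [NormedSpace ℝ W]
    {V : Type*} [NormedAddCommGroup V] [NormedSpace ℝ V]
    [MeasurableSpace V] [BorelSpace V] {u : V → W} (hu : ContDiff ℝ ∞ u) (j : ℕ) :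
    Measurable fun x => ‖iteratedFDeriv ℝ j u x‖ₑ :=
  (hu.continuous_iteratedFDeriv (m := j) (by exact_mod_cast le_top)).enorm.measurable

/-- The weighted `L¹` norm of the derivatives of a layer. Each of the `i` derivatives that fall on the
cutoff costs a factor `τ⁻¹`, and the integral of the weight over `0 < t ≤ 2 τ` is of order
`τ^{a+1}`. -/
theorem exists_lintegral_layer_le (m : ℕ) {a : ℝ} (ha : -1 < a) :
    ∃ C : ℝ≥0, ∀ (τ : ℝ) (u : E → ℝ), 0 < τ → τ ≤ 1 → ContDiff ℝ ∞ u → ∀ j ≤ m + 1,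
      ∫⁻ p in {p : E × ℝ | 0 < p.2}, ENNReal.ofReal (p.2 ^ a) *
        ‖iteratedFDeriv ℝ j (layer τ u) p‖ₑ ≤ C * pieceCost (m - a) (m + 1) τ u := by
  obtain ⟨C, hC0, hC⟩ := exists_norm_iteratedFDeriv_cutoff_le (m + 1)
  let A : ℝ := 2 ^ (m + 1) * C * (2 ^ (a + 1) / (a + 1))
  have ha1 : 0 < a + 1 := by linarith
  have hA : 0 ≤ A := by positivity
  refine ⟨A.toNNReal, fun τ u hτ hτ1 hu j hj => ?_⟩
  have hΩ : MeasurableSet {p : E × ℝ | 0 < p.2} := measurableSet_lt measurable_const measurable_snd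
  -- The contribution of the terms with `i` derivatives on the cutoff.
  let T : ℕ → E × ℝ → ℝ≥0∞ := fun i p => ENNReal.ofReal (2 ^ (m + 1) * C * τ⁻¹ ^ i) *
    (‖iteratedFDeriv ℝ (j - i) u p.1‖ₑ *
      (Ioc 0 (2 * τ)).indicator (fun t => ENNReal.ofReal (t ^ a)) p.2)
  have hT : ∀ p ∈ {p : E × ℝ | 0 < p.2}, ENNReal.ofReal (p.2 ^ a) *
      ‖iteratedFDeriv ℝ j (layer τ u) p‖ₑ ≤ ∑ i ∈ Finset.range (j + 1), T i p := by
    rintro ⟨x, t⟩ (ht : 0 < t)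
    have hb := norm_iteratedFDeriv_layer_le hτ hu j (x, t)
    rcases le_or_gt t (2 * τ) with h2 | h2
    · have h3 : ‖iteratedFDeriv ℝ j (layer τ u) (x, t)‖ ≤ ∑ i ∈ Finset.range (j + 1),
          2 ^ (m + 1) * C * τ⁻¹ ^ i * ‖iteratedFDeriv ℝ (j - i) u x‖ := by
        refine hb.trans (Finset.sum_le_sum fun i hi => ?_)
        have hi' : i ≤ j := Nat.lt_succ_iff.1 (Finset.mem_range.1 hi)
        refine mul_le_mul_of_nonneg_right ?_ (norm_nonneg _)
        have h4 : (j.choose i : ℝ) ≤ 2 ^ (m + 1) := by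
          have : j.choose i ≤ 2 ^ (m + 1) :=
            (Nat.choose_le_two_pow j i).trans (Nat.pow_le_pow_right (by norm_num) hj)
          exact_mod_cast this
        calc (j.choose i : ℝ) * (τ⁻¹ ^ i * ‖iteratedFDeriv ℝ i cutoff (t / τ)‖)
            ≤ 2 ^ (m + 1) * (τ⁻¹ ^ i * C) := by
              gcongr
              exact hC i (hi'.trans hj) _ (by positivity)
          _ = 2 ^ (m + 1) * C * τ⁻¹ ^ i := by ring
      rw [← ofReal_norm]
      refine (mul_le_mul_right (ENNReal.ofReal_le_ofReal h3) _).trans (le_of_eq ?_)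
      rw [ENNReal.ofReal_sum_of_nonneg (fun i _ => by positivity), Finset.mul_sum]
      refine Finset.sum_congr rfl fun i _ => ?_
      simp only [T]
      rw [indicator_of_mem (show t ∈ Ioc 0 (2 * τ) from ⟨ht, h2⟩),
        ENNReal.ofReal_mul (by positivity), ofReal_norm]
      ring
    · have h3 : ‖iteratedFDeriv ℝ j (layer τ u) (x, t)‖ = 0 := by
        refine le_antisymm ?_ (norm_nonneg _)
        refine hb.trans (le_of_eq (Finset.sum_eq_zero fun i _ => ?_))
        rw [iteratedFDeriv_cutoff_of_two_lt (by rwa [lt_div_iff₀ hτ])]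
        simp
      rw [← ofReal_norm, h3, ENNReal.ofReal_zero, mul_zero]
      exact zero_le
  have hTint : ∀ i ∈ Finset.range (j + 1), ∫⁻ p, T i p ≤ ENNReal.ofReal A *
      (ENNReal.ofReal (τ ^ (((j - i : ℕ) : ℝ) - (m - a))) *
        ∫⁻ x, ‖iteratedFDeriv ℝ (j - i) u x‖ₑ) := by
    intro i hi
    have hi' : i ≤ j := Nat.lt_succ_iff.1 (Finset.mem_range.1 hi)
    have hm1 := measurable_enorm_iteratedFDeriv hu (j - i)
    have hm2 : Measurable ((Ioc 0 (2 * τ)).indicator (fun t : ℝ => ENNReal.ofReal (t ^ a))) :=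
      (Measurable.indicator (by fun_prop) measurableSet_Ioc)
    have hm3 : Measurable fun p : E × ℝ => ‖iteratedFDeriv ℝ (j - i) u p.1‖ₑ *
        (Ioc 0 (2 * τ)).indicator (fun t => ENNReal.ofReal (t ^ a)) p.2 :=
      (hm1.comp measurable_fst).mul (hm2.comp measurable_snd)
    simp only [T]
    rw [lintegral_const_mul _ hm3,
      show (volume : Measure (E × ℝ)) = volume.prod volume from rfl,
      lintegral_prod_mul hm1.aemeasurable hm2.aemeasurable,
      lintegral_indicator measurableSet_Ioc, lintegral_Ioc_rpow ha (by positivity),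
      mul_comm (∫⁻ x, _), ← mul_assoc, ← mul_assoc, ← ENNReal.ofReal_mul (by positivity),
      ← ENNReal.ofReal_mul (by positivity)]
    refine mul_le_mul_left (ENNReal.ofReal_le_ofReal ?_) _
    have e1 : 2 ^ (m + 1) * C * τ⁻¹ ^ i * ((2 * τ) ^ (a + 1) / (a + 1)) =
        A * τ ^ (a + 1 - i) := by
      rw [Real.mul_rpow (by norm_num) hτ.le, Real.rpow_sub hτ, Real.rpow_natCast, inv_pow]
      simp only [A]
      ring
    rw [e1]
    refine mul_le_mul_of_nonneg_left ?_ hA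
    apply Real.rpow_le_rpow_of_exponent_ge hτ hτ1
    rw [Nat.cast_sub hi']
    have : (j : ℝ) ≤ m + 1 := by exact_mod_cast hj
    linarith
  calc _ ≤ ∫⁻ p in {p : E × ℝ | 0 < p.2}, ∑ i ∈ Finset.range (j + 1), T i p :=
        setLIntegral_mono' hΩ hT
    _ ≤ ∫⁻ p, ∑ i ∈ Finset.range (j + 1), T i p := setLIntegral_le_lintegral _ _
    _ = ∑ i ∈ Finset.range (j + 1), ∫⁻ p, T i p := by
        refine lintegral_finsetSum _ fun i _ => ?_
        have hm1 := measurable_enorm_iteratedFDeriv hu (j - i)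
        have hm2 : Measurable ((Ioc 0 (2 * τ)).indicator (fun t : ℝ => ENNReal.ofReal (t ^ a))) :=
          (Measurable.indicator (by fun_prop) measurableSet_Ioc)
        exact ((hm1.comp measurable_fst).mul (hm2.comp measurable_snd)).const_mul _
    _ ≤ ∑ i ∈ Finset.range (j + 1), ENNReal.ofReal A *
      (ENNReal.ofReal (τ ^ (((j - i : ℕ) : ℝ) - (m - a))) *
        ∫⁻ x, ‖iteratedFDeriv ℝ (j - i) u x‖ₑ) := Finset.sum_le_sum hTint
    _ = ENNReal.ofReal A * ∑ l ∈ Finset.range (j + 1),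
      (ENNReal.ofReal (τ ^ ((l : ℝ) - (m - a))) * ∫⁻ x, ‖iteratedFDeriv ℝ l u x‖ₑ) := by
        rw [← Finset.mul_sum, ← Finset.sum_range_reflect]
        refine congrArg _ (Finset.sum_congr rfl fun i hi => ?_)
        have := Finset.mem_range.1 hi
        rw [show j + 1 - 1 - i = j - i by omega, show j - (j - i) = i by omega]
    _ ≤ _ := by
        refine mul_le_mul_right (Finset.sum_le_sum_of_subset ?_) _
        exact Finset.range_mono (by omega)

end Layers

section LayeredExtension

variable {E : Type*} [NormedAddCommGroup E] [NormedSpace ℝ E]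

/-- The superposition of the layers `u k`, the `k`-th being cut off at height `2 τ k`. If `τ k → 0`, the
sum is locally finite in the half-space. -/
noncomputable def layeredExtension (τ : ℕ → ℝ) (u : ℕ → E → ℝ) (p : E × ℝ) : ℝ :=
  ∑' k, layer (τ k) (u k) p

theorem exists_layeredExtension_eq_sum {τ : ℕ → ℝ} (hτ0 : ∀ k, 0 < τ k)
    (hτ : Tendsto τ atTop (𝓝 0)) (u : ℕ → E → ℝ) {δ : ℝ} (hδ : 0 < δ) :
    ∃ N, ∀ K ≥ N, ∀ p : E × ℝ, δ ≤ p.2 →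
      layeredExtension τ u p = ∑ k ∈ Finset.range K, layer (τ k) (u k) p := by
  obtain ⟨N, hN⟩ := eventually_atTop.1 (hτ.eventually (gt_mem_nhds (half_pos hδ)))
  refine ⟨N, fun K hK p hp => tsum_eq_sum fun k hk => ?_⟩
  have hk' : τ k < δ / 2 := hN k (hK.trans (not_lt.1 fun h => hk (Finset.mem_range.2 h)))
  rw [layer, cutoff_of_two_le, zero_mul]
  rw [le_div_iff₀ (hτ0 k)]
  linarith

theorem exists_layeredExtension_eventuallyEq {τ : ℕ → ℝ} (hτ0 : ∀ k, 0 < τ k)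
    (hτ : Tendsto τ atTop (𝓝 0)) (u : ℕ → E → ℝ) {δ : ℝ} (hδ : 0 < δ) :
    ∃ K, ∀ p : E × ℝ, δ < p.2 →
      layeredExtension τ u =ᶠ[𝓝 p] fun q => ∑ k ∈ Finset.range K, layer (τ k) (u k) q := by
  obtain ⟨N, hN⟩ := exists_layeredExtension_eq_sum hτ0 hτ u hδ
  refine ⟨N, fun p hp => ?_⟩
  filter_upwards [(isOpen_lt continuous_const continuous_snd).mem_nhds hp] with q hq
  exact hN N le_rfl q (le_of_lt hq)

theorem layeredExtension_smooth {τ : ℕ → ℝ} (hτ0 : ∀ k, 0 < τ k)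
    (hτ : Tendsto τ atTop (𝓝 0)) {u : ℕ → E → ℝ} (hu : ∀ k, ContDiff ℝ ∞ (u k))
    {S : Set (E × ℝ)} (hS : S ⊆ {p | 0 < p.2}) (hc : IsCompact S) :
    ∃ w : E × ℝ → ℝ, ContDiff ℝ ∞ w ∧ ∀ p ∈ S, layeredExtension τ u =ᶠ[𝓝 p] w := by
  obtain ⟨δ, hδ, hδS⟩ : ∃ δ : ℝ, 0 < δ ∧ ∀ p ∈ S, δ < p.2 := by
    rcases S.eq_empty_or_nonempty with rfl | hne
    · exact ⟨1, one_pos, by simp⟩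
    · obtain ⟨p, hp, hmin⟩ := hc.exists_isMinOn hne continuous_snd.continuousOn
      have h0 : 0 < p.2 := hS hp
      exact ⟨p.2 / 2, half_pos h0, fun q hq => (half_lt_self h0).trans_le (hmin hq)⟩
  obtain ⟨K, hK⟩ := exists_layeredExtension_eventuallyEq hτ0 hτ u hδ
  exact ⟨_, ContDiff.sum fun k _ => contDiff_layer (τ k) (hu k), fun p hp => hK p (hδS p hp)⟩

theorem enorm_iteratedFDeriv_layeredExtension_le {τ : ℕ → ℝ} (hτ0 : ∀ k, 0 < τ k)
    (hτ : Tendsto τ atTop (𝓝 0)) {u : ℕ → E → ℝ} (hu : ∀ k, ContDiff ℝ ∞ (u k))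
    (j : ℕ) {p : E × ℝ} (hp : 0 < p.2) :
    ‖iteratedFDeriv ℝ j (layeredExtension τ u) p‖ₑ ≤
      ∑' k, ‖iteratedFDeriv ℝ j (layer (τ k) (u k)) p‖ₑ := by
  obtain ⟨K, hK⟩ := exists_layeredExtension_eventuallyEq hτ0 hτ u (half_pos hp)
  rw [((hK p (half_lt_self hp)).iteratedFDeriv ℝ j).eq_of_nhds]
  rw [iteratedFDeriv_fun_sum_apply fun k _ => ((contDiff_layer (τ k) (hu k)).of_le
    (by exact_mod_cast le_top)).contDiffAt]
  refine le_trans ?_ (ENNReal.sum_le_tsum (Finset.range K))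
  simp_rw [← ofReal_norm]
  rw [← ENNReal.ofReal_sum_of_nonneg fun _ _ => norm_nonneg _]
  exact ENNReal.ofReal_le_ofReal (norm_sum_le _ _)

variable [MeasureSpace E] [FiniteDimensional ℝ E] [BorelSpace E] [SFinite (volume : Measure E)]

theorem exists_lintegral_layeredExtension_le (m : ℕ) {a : ℝ} (ha : -1 < a) :
    ∃ C : ℝ≥0, ∀ (τ : ℕ → ℝ) (u : ℕ → E → ℝ), (∀ k, 0 < τ k) → (∀ k, τ k ≤ 1) →
      Tendsto τ atTop (𝓝 0) → (∀ k, ContDiff ℝ ∞ (u k)) → ∀ j ≤ m + 1,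
      ∫⁻ p in {p : E × ℝ | 0 < p.2}, ENNReal.ofReal (p.2 ^ a) *
        ‖iteratedFDeriv ℝ j (layeredExtension τ u) p‖ₑ ≤
          C * ∑' k, pieceCost (m - a) (m + 1) (τ k) (u k) := by
  obtain ⟨C, hC⟩ := exists_lintegral_layer_le (E := E) m ha
  refine ⟨C, fun τ u hτ0 hτ1 hτ hu j hj => ?_⟩
  have hΩ : MeasurableSet {p : E × ℝ | 0 < p.2} := measurableSet_lt measurable_const measurable_snd
  calc _ ≤ ∫⁻ p in {p : E × ℝ | 0 < p.2}, ∑' k, ENNReal.ofReal (p.2 ^ a) *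
        ‖iteratedFDeriv ℝ j (layer (τ k) (u k)) p‖ₑ := by
        refine setLIntegral_mono' hΩ fun p hp => ?_
        rw [ENNReal.tsum_mul_left]
        gcongr
        exact enorm_iteratedFDeriv_layeredExtension_le hτ0 hτ hu j hp
    _ = ∑' k, ∫⁻ p in {p : E × ℝ | 0 < p.2}, ENNReal.ofReal (p.2 ^ a) *
        ‖iteratedFDeriv ℝ j (layer (τ k) (u k)) p‖ₑ := by
        refine lintegral_tsum fun k => Measurable.aemeasurable ?_
        exact (by fun_prop : Measurable fun p : E × ℝ => ENNReal.ofReal (p.2 ^ a)).mul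
          (measurable_enorm_iteratedFDeriv (contDiff_layer (τ k) (hu k)) j)
    _ ≤ ∑' k, C * pieceCost (m - a) (m + 1) (τ k) (u k) :=
        ENNReal.tsum_le_tsum fun k => hC (τ k) (u k) (hτ0 k) (hτ1 k) (hu k) j hj
    _ = _ := ENNReal.tsum_mul_left

theorem lintegral_enorm_le_pieceCost {s : ℝ} (hs : 0 ≤ s) (J : ℕ) {τ : ℝ} (h0 : 0 < τ)
    (h1 : τ ≤ 1) (u : E → ℝ) : ∫⁻ x, ‖u x‖ₑ ≤ pieceCost s J τ u := by
  have h : 1 ≤ ENNReal.ofReal (τ ^ (((0 : ℕ) : ℝ) - s)) := by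
    rw [← ENNReal.ofReal_one]
    refine ENNReal.ofReal_le_ofReal (Real.one_le_rpow_of_pos_of_le_one_of_nonpos h0 h1 ?_)
    simpa using hs
  have e : ∫⁻ x, ‖u x‖ₑ = ∫⁻ x, ‖iteratedFDeriv ℝ 0 u x‖ₑ := by
    refine lintegral_congr fun x => ?_
    rw [← ofReal_norm, ← ofReal_norm, norm_iteratedFDeriv_zero]
  calc ∫⁻ x, ‖u x‖ₑ ≤ ENNReal.ofReal (τ ^ (((0 : ℕ) : ℝ) - s)) *
        ∫⁻ x, ‖iteratedFDeriv ℝ 0 u x‖ₑ := by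
        rw [e]; exact le_mul_of_one_le_left zero_le h
    _ ≤ _ := Finset.single_le_sum (f := fun l : ℕ => ENNReal.ofReal (τ ^ ((l : ℝ) - s)) *
        ∫⁻ x, ‖iteratedFDeriv ℝ l u x‖ₑ) (fun _ _ => zero_le) (Finset.mem_range.2 (by omega))

theorem lintegral_layeredExtension_sub_le {τ : ℕ → ℝ} (hτ0 : ∀ k, 0 < τ k)
    (hτ : Tendsto τ atTop (𝓝 0)) {u : ℕ → E → ℝ} (hu : ∀ k, Continuous (u k)) {f : E → ℝ}
    (hf : Tendsto (fun K => ∫⁻ x, ‖f x - ∑ k ∈ Finset.range K, u k x‖ₑ) atTop (𝓝 0))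
    {t : ℝ} (ht : 0 < t) :
    ∫⁻ x, ‖layeredExtension τ u (x, t) - f x‖ₑ ≤
      ∑' k, ‖cutoff (t / τ k) - 1‖ₑ * ∫⁻ x, ‖u k x‖ₑ := by
  obtain ⟨N, hN⟩ := exists_layeredExtension_eq_sum hτ0 hτ u ht
  have hlim : Tendsto (fun K => (∑' k, ‖cutoff (t / τ k) - 1‖ₑ * ∫⁻ x, ‖u k x‖ₑ) +
      ∫⁻ x, ‖f x - ∑ k ∈ Finset.range K, u k x‖ₑ) atTop
      (𝓝 (∑' k, ‖cutoff (t / τ k) - 1‖ₑ * ∫⁻ x, ‖u k x‖ₑ)) := by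
    simpa using tendsto_const_nhds.add hf
  refine ge_of_tendsto hlim ?_
  filter_upwards [eventually_ge_atTop N] with K hK
  calc ∫⁻ x, ‖layeredExtension τ u (x, t) - f x‖ₑ
      ≤ ∫⁻ x, ((∑ k ∈ Finset.range K, ‖cutoff (t / τ k) - 1‖ₑ * ‖u k x‖ₑ) +
          ‖f x - ∑ k ∈ Finset.range K, u k x‖ₑ) := by
        refine lintegral_mono fun x => ?_
        have e : layeredExtension τ u (x, t) - f x =
            (∑ k ∈ Finset.range K, (cutoff (t / τ k) - 1) * u k x) -
              (f x - ∑ k ∈ Finset.range K, u k x) := by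
          rw [hN K hK (x, t) le_rfl]
          simp only [layer, sub_mul, one_mul, Finset.sum_sub_distrib]
          ring
        rw [e]
        refine (enorm_sub_le).trans (add_le_add_left ((enorm_sum_le _ _).trans ?_) _)
        exact le_of_eq (Finset.sum_congr rfl fun k _ => enorm_mul _ _)
    _ = (∑ k ∈ Finset.range K, ‖cutoff (t / τ k) - 1‖ₑ * ∫⁻ x, ‖u k x‖ₑ) +
          ∫⁻ x, ‖f x - ∑ k ∈ Finset.range K, u k x‖ₑ := by
        rw [lintegral_add_left, lintegral_finsetSum]
        · simp_rw [lintegral_const_mul _ (hu _).enorm.measurable]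
        · exact fun k _ => (hu k).enorm.measurable.const_mul _
        · exact Finset.measurable_fun_sum _ fun k _ => (hu k).enorm.measurable.const_mul _
    _ ≤ _ := add_le_add_left (ENNReal.sum_le_tsum _) _

/-- The slices of the layered extension converge in `L¹` to the sum of the pieces: the slice at height
`t` differs from it by at most `∑ k, |cutoff (t / τ k) - 1| * ‖u k‖`, in which any finite number of terms
vanish when `t` is small. -/
theorem tendsto_layeredExtension {τ : ℕ → ℝ} (hτ0 : ∀ k, 0 < τ k)
    (hτ : Tendsto τ atTop (𝓝 0)) {u : ℕ → E → ℝ} (hu : ∀ k, Continuous (u k))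
    (hsum : ∑' k, ∫⁻ x, ‖u k x‖ₑ ≠ ⊤) {f : E → ℝ}
    (hf : Tendsto (fun K => ∫⁻ x, ‖f x - ∑ k ∈ Finset.range K, u k x‖ₑ) atTop (𝓝 0)) :
    Tendsto (fun t : ℝ => ∫⁻ x, ‖layeredExtension τ u (x, t) - f x‖ₑ) (𝓝[>] (0 : ℝ)) (𝓝 0) := by
  rw [ENNReal.tendsto_nhds_zero]
  intro ε hε
  have htail := ENNReal.tendsto_sum_nat_add (fun k => ∫⁻ x, ‖u k x‖ₑ) hsum
  obtain ⟨N, hN⟩ : ∃ N, ∑' k, ∫⁻ x, ‖u (k + N) x‖ₑ ≤ ε :=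
    ((ENNReal.tendsto_nhds_zero.1 htail) ε hε).exists
  have hsmall : ∀ᶠ t in 𝓝[>] (0 : ℝ), ∀ k ∈ Finset.range N, t < τ k :=
    (Finset.eventually_all _).2 fun k _ => nhdsWithin_le_nhds (Iio_mem_nhds (hτ0 k))
  filter_upwards [self_mem_nhdsWithin, hsmall] with t ht htk
  refine (lintegral_layeredExtension_sub_le hτ0 hτ hu hf ht).trans (le_trans ?_ hN)
  have hsplit := Summable.sum_add_tsum_nat_add' (k := N)
    (f := fun k => ‖cutoff (t / τ k) - 1‖ₑ * ∫⁻ x, ‖u k x‖ₑ) ENNReal.summable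
  rw [← hsplit, Finset.sum_eq_zero, zero_add]
  · refine ENNReal.tsum_le_tsum fun k => mul_le_of_le_one_left zero_le ?_
    rw [← ofReal_norm, ← ENNReal.ofReal_one]
    exact ENNReal.ofReal_le_ofReal (abs_cutoff_sub_one_le _)
  · intro k hk
    rw [cutoff_of_le_one, sub_self, enorm_zero, zero_mul]
    exact (div_le_one (hτ0 k)).2 (htk k hk).le

end LayeredExtension

section HalfSpace

variable {n : ℕ}

instance : (volume : Measure (EuclideanSpace ℝ (Fin n) × ℝ)).IsAddHaarMeasure :=
  Measure.prod.instIsAddHaarMeasure volume volume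

theorem isOpen_halfSpace : IsOpen (halfSpace n) := isOpen_lt continuous_const continuous_snd

theorem norm_halfDir (i : Fin n ⊕ Unit) : ‖halfDir n i‖ = 1 := by
  rcases i with i | i <;> simp [halfDir, dir, Prod.norm_def]

/-- On the half-space, `|∇^j F|` is at most the number of words times the norm of the classical
derivative. -/
theorem gradNorm_le {F : EuclideanSpace ℝ (Fin n) × ℝ → ℝ} {j : ℕ}
    (hF : ∀ v : Fin j → EuclideanSpace ℝ (Fin n) × ℝ,
      HasWeakDeriv (halfSpace n) v F (fun p => iteratedFDeriv ℝ j F p v)) :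
    ∀ᵐ p ∂(volume.restrict (halfSpace n)), gradNorm (halfSpace n) (halfDir n) j F p ≤
      (n + 1) ^ j * ‖iteratedFDeriv ℝ j F p‖ := by
  have h : ∀ᵐ p ∂(volume.restrict (halfSpace n)), ∀ w : Fin j → Fin n ⊕ Unit,
      weakDeriv (halfSpace n) (fun i => halfDir n (w i)) F p =
        iteratedFDeriv ℝ j F p (fun i => halfDir n (w i)) :=
    ae_all_iff.2 fun w => (hF _).weakDeriv_ae_eq isOpen_halfSpace
  filter_upwards [h] with p hp
  have hw : ∀ w : Fin j → Fin n ⊕ Unit,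
      |weakDeriv (halfSpace n) (fun i => halfDir n (w i)) F p| ≤ ‖iteratedFDeriv ℝ j F p‖ := by
    intro w
    rw [hp w]
    refine ((iteratedFDeriv ℝ j F p).le_opNorm _).trans ?_
    simp [norm_halfDir]
  rw [gradNorm]
  calc √(∑ w : Fin j → Fin n ⊕ Unit,
        (weakDeriv (halfSpace n) (fun i => halfDir n (w i)) F p) ^ 2)
      ≤ √((∑ w : Fin j → Fin n ⊕ Unit,
          |weakDeriv (halfSpace n) (fun i => halfDir n (w i)) F p|) ^ 2) := by
        refine Real.sqrt_le_sqrt ?_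
        simp_rw [← sq_abs (weakDeriv _ _ F p)]
        exact Finset.sum_sq_le_sq_sum_of_nonneg fun _ _ => abs_nonneg _
    _ = ∑ w : Fin j → Fin n ⊕ Unit,
          |weakDeriv (halfSpace n) (fun i => halfDir n (w i)) F p| :=
        Real.sqrt_sq (Finset.sum_nonneg fun _ _ => abs_nonneg _)
    _ ≤ ∑ w : Fin j → Fin n ⊕ Unit, ‖iteratedFDeriv ℝ j F p‖ := Finset.sum_le_sum fun w _ => hw w
    _ = _ := by simp

/-- A function that is the `L¹` sum of smooth pieces of summable cost extends to the half-space. -/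
theorem exists_extension_of_pieces (n m : ℕ) {a : ℝ} (ha : -1 < a) (ham : a ≤ m) :
    ∃ C : ℝ≥0, ∀ (τ : ℕ → ℝ) (u : ℕ → EuclideanSpace ℝ (Fin n) → ℝ)
      (f : EuclideanSpace ℝ (Fin n) → ℝ), (∀ k, 0 < τ k) → (∀ k, τ k ≤ 1) →
      Tendsto τ atTop (𝓝 0) → (∀ k, ContDiff ℝ ∞ (u k)) →
      Tendsto (fun K => ∫⁻ x, ‖f x - ∑ k ∈ Finset.range K, u k x‖ₑ) atTop (𝓝 0) →
      ∑' k, pieceCost (m - a) (m + 1) (τ k) (u k) < ⊤ →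
      ∃ F : EuclideanSpace ℝ (Fin n) × ℝ → ℝ, MemWeighted n a (m + 1) F ∧ IsTrace n F f ∧
        weightedNorm n a (m + 1) F ≤ C * ∑' k, pieceCost (m - a) (m + 1) (τ k) (u k) := by
  obtain ⟨C, hC⟩ := exists_lintegral_layeredExtension_le (E := EuclideanSpace ℝ (Fin n)) m ha
  let A : ℝ≥0 := C + ∑ j ∈ Finset.Icc 1 (m + 1), ((n : ℝ≥0) + 1) ^ j * C
  refine ⟨A, fun τ u f hτ0 hτ1 hτ hu hf hsum => ?_⟩
  let F := layeredExtension τ u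
  have hF : ∀ (j : ℕ) (v : Fin j → EuclideanSpace ℝ (Fin n) × ℝ),
      HasWeakDeriv (halfSpace n) v F (fun p => iteratedFDeriv ℝ j F p v) := fun j v =>
    hasWeakDeriv_of_forall_compact isOpen_halfSpace
      (fun S hS hc => layeredExtension_smooth hτ0 hτ hu hS hc) v
  have hnorm : weightedNorm n a (m + 1) F ≤
      A * ∑' k, pieceCost (m - a) (m + 1) (τ k) (u k) := by
    have h0 : ∫⁻ p in halfSpace n, ENNReal.ofReal (p.2 ^ a * |F p|) ≤
        C * ∑' k, pieceCost (m - a) (m + 1) (τ k) (u k) := by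
      refine le_trans (le_of_eq ?_) (hC τ u hτ0 hτ1 hτ hu 0 (by omega))
      refine setLIntegral_congr_fun isOpen_halfSpace.measurableSet fun p hp => ?_
      have hp' : 0 < p.2 := hp
      rw [ENNReal.ofReal_mul (Real.rpow_nonneg hp'.le _), ← Real.norm_eq_abs,
        ← norm_iteratedFDeriv_zero (𝕜 := ℝ) (f := F), ofReal_norm]
    have hj : ∀ j ∈ Finset.Icc 1 (m + 1), weightedSeminorm n a j F ≤
        (((n : ℝ≥0) + 1) ^ j * C : ℝ≥0) * ∑' k, pieceCost (m - a) (m + 1) (τ k) (u k) := by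
      intro j hj
      have hj' := (Finset.mem_Icc.1 hj).2
      rw [ENNReal.coe_mul, mul_assoc]
      refine le_trans ?_ (mul_le_mul_right (hC τ u hτ0 hτ1 hτ hu j hj') _)
      rw [← lintegral_const_mul' _ _ ENNReal.coe_ne_top]
      refine lintegral_mono_ae ?_
      filter_upwards [gradNorm_le (hF j), ae_restrict_mem isOpen_halfSpace.measurableSet]
        with p hp hp0
      have hp' : 0 < p.2 := hp0
      have hw : 0 ≤ p.2 ^ a := Real.rpow_nonneg hp'.le _
      calc ENNReal.ofReal (p.2 ^ a * gradNorm (halfSpace n) (halfDir n) j F p)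
          ≤ ENNReal.ofReal (p.2 ^ a * ((n + 1) ^ j * ‖iteratedFDeriv ℝ j F p‖)) := by
            gcongr
        _ = _ := by
            rw [mul_left_comm, ENNReal.ofReal_mul (by positivity), ENNReal.ofReal_mul hw,
              ofReal_norm]
            congr 1
            rw [← ENNReal.ofReal_coe_nnreal]
            simp
    calc weightedNorm n a (m + 1) F ≤ _ := add_le_add h0 (Finset.sum_le_sum hj)
      _ = _ := by
        rw [← Finset.sum_mul, ← add_mul]
        simp only [A]
        push_cast
        rfl
  refine ⟨F, ⟨fun j _ w => ⟨_, hF j _⟩, hnorm.trans_lt (ENNReal.mul_lt_top ENNReal.coe_lt_top hsum)⟩,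
    ?_, hnorm⟩
  refine (tendsto_layeredExtension hτ0 hτ (fun k => (hu k).continuous) ?_ hf).mono_left inf_le_left
  refine ne_top_of_le_ne_top hsum.ne (ENNReal.tsum_le_tsum fun k => ?_)
  exact lintegral_enorm_le_pieceCost (by linarith) _ (hτ0 k) (hτ1 k) _

end HalfSpace

/-! ### Convolution with smooth kernels -/

section Convolution

variable {E : Type*} [NormedAddCommGroup E] [NormedSpace ℝ E] [FiniteDimensional ℝ E]
  [MeasureSpace E] [BorelSpace E] [(volume : Measure E).IsAddHaarMeasure]
  {W : Type*} [NormedAddCommGroup W] [NormedSpace ℝ W]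

/-- The convolution `x ↦ ∫ f y • K (x - y) dy` of a scalar function and a kernel. -/
noncomputable abbrev conv (f : E → ℝ) (K : E → W) : E → W :=
  convolution f K (ContinuousLinearMap.lsmul ℝ ℝ) volume

theorem conv_apply (f : E → ℝ) (K : E → W) (x : E) : conv f K x = ∫ y, f y • K (x - y) := rfl

variable {f g : E → ℝ} {K : E → W}

theorem contDiff_conv (hf : LocallyIntegrable f volume) (hK : ContDiff ℝ ∞ K)
    (hc : HasCompactSupport K) : ContDiff ℝ ∞ (conv f K) :=
  hc.contDiff_convolution_right _ hf hK

theorem fderiv_conv (hf : LocallyIntegrable f volume) (hK : ContDiff ℝ ∞ K)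
    (hc : HasCompactSupport K) : fderiv ℝ (conv f K) = conv f (fderiv ℝ K) := by
  funext x
  exact (hc.hasFDerivAt_convolution_right _ hf (hK.of_le (by exact_mod_cast le_top)) x).fderiv

theorem linearIsometryEquiv_integral (A B : Type*) [NormedAddCommGroup A] [NormedSpace ℝ A]
    [NormedAddCommGroup B] [NormedSpace ℝ B] (L : A ≃ₗᵢ[ℝ] B) (φ : E → A) :
    L (∫ y, φ y) = ∫ y, L (φ y) :=
  (L.toContinuousLinearEquiv.integral_comp_comm φ).symm

theorem iteratedFDeriv_conv (hf : LocallyIntegrable f volume) (hK : ContDiff ℝ ∞ K)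
    (hc : HasCompactSupport K) (j : ℕ) :
    iteratedFDeriv ℝ j (conv f K) = conv f (iteratedFDeriv ℝ j K) := by
  induction j with
  | zero =>
    funext x
    rw [iteratedFDeriv_zero_eq_comp, iteratedFDeriv_zero_eq_comp, Function.comp_apply,
      conv_apply, conv_apply]
    rw [← LinearIsometryEquiv.coe_toContinuousLinearEquiv, ← ContinuousLinearEquiv.integral_comp_comm]
    simp only [map_smul, Function.comp_apply]
  | succ j ih =>
    funext x
    rw [iteratedFDeriv_succ_eq_comp_left, iteratedFDeriv_succ_eq_comp_left, ih,
      fderiv_conv hf (hK.iteratedFDeriv_right (m := ∞) (by exact_mod_cast le_top))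
        (hc.iteratedFDeriv (𝕜 := ℝ) j), Function.comp_apply, conv_apply, conv_apply]
    refine (linearIsometryEquiv_integral (E := E) (E →L[ℝ] E [×j]→L[ℝ] W) (E [×(j + 1)]→L[ℝ] W)
      (continuousMultilinearCurryLeftEquiv ℝ (fun _ : Fin (j + 1) => E) W).symm _).trans ?_
    exact integral_congr_ae (Eventually.of_forall fun y => map_smul _ _ _)

theorem lintegral_enorm_conv_le (hf : AEStronglyMeasurable f volume) (hK : Continuous K) :
    ∫⁻ x, ‖conv f K x‖ₑ ≤ (∫⁻ x, ‖K x‖ₑ) * ∫⁻ x, ‖f x‖ₑ := by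
  have hm : AEMeasurable (Function.uncurry fun x y : E => ‖f y‖ₑ * ‖K (x - y)‖ₑ)
      (volume.prod volume) :=
    hf.enorm.comp_snd.mul (hK.enorm.measurable.comp
      (measurable_fst.sub measurable_snd)).aemeasurable
  calc ∫⁻ x, ‖conv f K x‖ₑ ≤ ∫⁻ x, ∫⁻ y, ‖f y‖ₑ * ‖K (x - y)‖ₑ := by
        refine lintegral_mono fun x => ?_
        rw [conv_apply]
        refine (enorm_integral_le_lintegral_enorm _).trans (le_of_eq ?_)
        simp_rw [enorm_smul]
    _ = ∫⁻ y, ∫⁻ x, ‖f y‖ₑ * ‖K (x - y)‖ₑ := lintegral_lintegral_swap hm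
    _ = ∫⁻ y, (∫⁻ x, ‖K x‖ₑ) * ‖f y‖ₑ := by
        refine lintegral_congr fun y => ?_
        rw [lintegral_const_mul' _ _ enorm_ne_top, lintegral_sub_right_eq_self (fun x => ‖K x‖ₑ),
          mul_comm]
    _ = _ := lintegral_const_mul'' _ hf.enorm

theorem iteratedFDeriv_conv_apply {K : E → ℝ} (hf : LocallyIntegrable f volume) (hK : ContDiff ℝ ∞ K)
    (hc : HasCompactSupport K) {k : ℕ} (v : Fin k → E) (x : E) :
    iteratedFDeriv ℝ k (conv f K) x v = ∫ y, f y * iteratedFDeriv ℝ k K (x - y) v := by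
  have hi := (hc.iteratedFDeriv (𝕜 := ℝ) k).convolutionExists_right
    (ContinuousLinearMap.lsmul ℝ ℝ) hf
    (hK.continuous_iteratedFDeriv (m := k) (by exact_mod_cast le_top)) x
  rw [iteratedFDeriv_conv hf hK hc, conv_apply]
  exact ((ContinuousMultilinearMap.apply ℝ (fun _ : Fin k => E) ℝ v).integral_comp_comm hi).symm

/-- Convolution with a smooth kernel turns weak derivatives into classical ones. -/
theorem HasWeakDeriv.iteratedFDeriv_conv {K : E → ℝ} {k : ℕ} {v : Fin k → E}
    (h : HasWeakDeriv univ v f g) (hK : ContDiff ℝ ∞ K) (hc : HasCompactSupport K) (x : E) :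
    iteratedFDeriv ℝ k (conv f K) x v = conv g K x := by
  have hφ : ContDiff ℝ ∞ (fun y => K (x - y)) := hK.comp (contDiff_const.sub contDiff_id)
  have hφc : HasCompactSupport (fun y => K (x - y)) := hc.comp_homeomorph (Homeomorph.subLeft x)
  have hD : ∀ y, iteratedFDeriv ℝ k (fun y => K (x - y)) y v =
      (-1) ^ k * iteratedFDeriv ℝ k K (x - y) v := by
    intro y
    have e : (fun y => K (x - y)) = fun y => (fun z => K (x + z)) ((-1 : ℝ) • y) := by
      funext y; simp [sub_eq_add_neg]
    have hG : ContDiff ℝ ∞ (fun z => K (x + z)) := hK.comp (contDiff_const.add contDiff_id)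
    rw [e, iteratedFDeriv_comp_const_smul _ (hG.of_le (by exact_mod_cast le_top)), iteratedFDeriv_comp_add_left']
    simp [sub_eq_add_neg]
  have key := h.2.2 _ hφ hφc (subset_univ _)
  simp only [setIntegral_univ, hD, mul_left_comm (f _), integral_const_mul] at key
  rw [iteratedFDeriv_conv_apply (locallyIntegrableOn_univ.1 h.1) hK hc,
    mul_left_cancel₀ (pow_ne_zero k (by norm_num)) key, conv_apply]
  simp only [smul_eq_mul]

theorem conv_comm {K L : E → ℝ} (hf : Integrable f volume) (hK : Continuous K)
    (hKc : HasCompactSupport K) (hL : Continuous L) (hLc : HasCompactSupport L) :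
    conv (conv f K) L = conv (conv f L) K := by
  have key : ∀ K L : E → ℝ, Continuous K → HasCompactSupport K → Continuous L →
      HasCompactSupport L → ∀ x, conv (conv f K) L x = conv f (conv K L) x := by
    intro K L hK hKc hL hLc x
    refine convolution_assoc (ContinuousLinearMap.lsmul ℝ ℝ) (ContinuousLinearMap.lsmul ℝ ℝ)
      (ContinuousLinearMap.lsmul ℝ ℝ) (ContinuousLinearMap.lsmul ℝ ℝ)
      (fun x y z => by simp [mul_assoc]) hf.1 hK.aestronglyMeasurable hL.aestronglyMeasurable
      (Eventually.of_forall (hKc.convolutionExists_right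
        (ContinuousLinearMap.lsmul ℝ ℝ : ℝ →L[ℝ] ℝ →L[ℝ] ℝ) hf.locallyIntegrable hK))
      (Eventually.of_forall (hLc.norm.convolutionExists_right (ContinuousLinearMap.mul ℝ ℝ)
        hK.norm.locallyIntegrable hL.norm)) ?_
    exact (hKc.norm.convolution (ContinuousLinearMap.mul ℝ ℝ) hLc.norm).convolutionExists_right
      (ContinuousLinearMap.mul ℝ ℝ) hf.norm.locallyIntegrable
      (hLc.norm.continuous_convolution_right (ContinuousLinearMap.mul ℝ ℝ)
        hK.norm.locallyIntegrable hL.norm) x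
  funext x
  rw [key K L hK hKc hL hLc, key L K hL hLc hK hKc]
  congr 1
  funext y
  rw [conv, conv, convolution_lsmul_swap, convolution_lsmul]
  simp only [smul_eq_mul, mul_comm]

/-- The dilation `y ↦ r^{-d} K (y / r)` of a kernel, which preserves its integral. -/
noncomputable def dilate (r : ℝ) (K : E → ℝ) (y : E) : ℝ :=
  (r ^ Module.finrank ℝ E)⁻¹ * K (r⁻¹ • y)

theorem contDiff_dilate (r : ℝ) {K : E → ℝ} (hK : ContDiff ℝ ∞ K) : ContDiff ℝ ∞ (dilate r K) :=
  contDiff_const.mul (hK.comp (contDiff_const_smul _))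

theorem hasCompactSupport_dilate {r : ℝ} (hr : 0 < r) {K : E → ℝ} (hK : HasCompactSupport K) :
    HasCompactSupport (dilate r K) :=
  (hK.comp_smul (inv_ne_zero hr.ne')).mul_left

theorem integral_mul_dilate (g K : E → ℝ) {r : ℝ} (hr : 0 < r) :
    ∫ y, g y * dilate r K y = ∫ y, g (r • y) * K y := by
  have h := Measure.integral_comp_smul volume (fun y => g y * K (r⁻¹ • y)) r
  simp only [smul_smul, inv_mul_cancel₀ hr.ne', one_smul] at h
  rw [h, abs_of_pos (by positivity), smul_eq_mul, ← integral_const_mul]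
  refine integral_congr_ae (Eventually.of_forall fun y => ?_)
  simp only [dilate]
  ring

theorem conv_dilate_apply (f K : E → ℝ) {r : ℝ} (hr : 0 < r) (x : E) :
    conv f (dilate r K) x = ∫ y, f (x - r • y) * K y := by
  rw [← integral_mul_dilate (fun y => f (x - y)) K hr, conv, convolution_lsmul_swap]
  rfl

theorem lintegral_mul_comp_smul {g K : E → ℝ≥0∞} (hg : Measurable g) (hK : Measurable K) {r : ℝ}
    (hr : 0 < r) :
    ∫⁻ y, g (r • y) * K y = ∫⁻ y, ENNReal.ofReal (r ^ Module.finrank ℝ E)⁻¹ *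
      (g y * K (r⁻¹ • y)) := by
  have hm : Measurable fun y => g y * K (r⁻¹ • y) := hg.mul (hK.comp (measurable_const_smul _))
  have h : ∫⁻ y, g (r • y) * K y = ∫⁻ z, g z * K (r⁻¹ • z) ∂(volume.map (r • · : E → E)) := by
    rw [lintegral_map hm (measurable_const_smul r)]
    simp only [smul_smul, inv_mul_cancel₀ hr.ne', one_smul]
  rw [h, Measure.map_addHaar_smul _ hr.ne', lintegral_smul_measure, abs_of_pos (by positivity),
    lintegral_const_mul _ hm, smul_eq_mul]

theorem lintegral_enorm_iteratedFDeriv_dilate {K : E → ℝ} (hK : ContDiff ℝ ∞ K) {r : ℝ}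
    (hr : 0 < r) (j : ℕ) :
    ∫⁻ y, ‖iteratedFDeriv ℝ j (dilate r K) y‖ₑ =
      ENNReal.ofReal (r⁻¹ ^ j) * ∫⁻ y, ‖iteratedFDeriv ℝ j K y‖ₑ := by
  have hK' := measurable_enorm_iteratedFDeriv hK j
  have hd : ∀ y, ‖iteratedFDeriv ℝ j (dilate r K) y‖ₑ = ENNReal.ofReal (r⁻¹ ^ j) *
      (ENNReal.ofReal (r ^ Module.finrank ℝ E)⁻¹ * (1 * ‖iteratedFDeriv ℝ j K (r⁻¹ • y)‖ₑ)) := by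
    intro y
    have e : dilate r K = fun y => (r ^ Module.finrank ℝ E)⁻¹ • (fun z => K (r⁻¹ • z)) y := rfl
    have hs : ContDiff ℝ ∞ (fun z => K (r⁻¹ • z)) := hK.comp (contDiff_const_smul _)
    rw [e, iteratedFDeriv_const_smul_apply' (hs.of_le (by exact_mod_cast le_top)).contDiffAt,
      iteratedFDeriv_comp_const_smul _ (hK.of_le (by exact_mod_cast le_top)), smul_smul,
      ← ofReal_norm, ← ofReal_norm, norm_smul, one_mul, Real.norm_of_nonneg (by positivity),
      ← ENNReal.ofReal_mul (by positivity), ← ENNReal.ofReal_mul (by positivity)]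
    congr 1
    ring
  simp_rw [hd]
  rw [lintegral_const_mul, ← lintegral_mul_comp_smul (g := fun _ => 1) measurable_const hK' hr]
  · simp
  · exact ((hK'.comp (measurable_const_smul _)).const_mul _).const_mul _

end Convolution

/-! ### Decomposition of a function by telescoping smooth approximations -/

section Telescoping

variable {E : Type*} [NormedAddCommGroup E] [NormedSpace ℝ E] [FiniteDimensional ℝ E]
  [MeasureSpace E] [BorelSpace E] [(volume : Measure E).IsAddHaarMeasure]

theorem lintegral_enorm_add_le {f g : E → ℝ} (hf : AEStronglyMeasurable f volume) :
    ∫⁻ x, ‖f x + g x‖ₑ ≤ (∫⁻ x, ‖f x‖ₑ) + ∫⁻ x, ‖g x‖ₑ := by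
  rw [← lintegral_add_left' hf.enorm]
  exact lintegral_mono fun x => enorm_add_le _ _

theorem lintegral_enorm_sub_le {f g : E → ℝ} (hf : AEStronglyMeasurable f volume) :
    ∫⁻ x, ‖f x - g x‖ₑ ≤ (∫⁻ x, ‖f x‖ₑ) + ∫⁻ x, ‖g x‖ₑ := by
  rw [← lintegral_add_left' hf.enorm]
  exact lintegral_mono fun x => enorm_sub_le

theorem integrable_conv {f K : E → ℝ} (hf : Integrable f volume) (hK : Continuous K)
    (hc : HasCompactSupport K) : Integrable (conv f K) volume :=
  Integrable.integrable_convolution _ hf (hK.integrable_of_hasCompactSupport hc)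

theorem conv_sub {f g K : E → ℝ} (hf : Integrable f volume) (hg : Integrable g volume)
    (hK : Continuous K) (hc : HasCompactSupport K) :
    conv (fun x => f x - g x) K = fun x => conv f K x - conv g K x := by
  funext x
  have h1 := hc.convolutionExists_right (ContinuousLinearMap.lsmul ℝ ℝ)
    hf.locallyIntegrable hK x
  have h2 := hc.convolutionExists_right (ContinuousLinearMap.lsmul ℝ ℝ)
    hg.locallyIntegrable hK x
  have := integral_sub h1.integrable h2.integrable
  simp only [conv_apply, sub_smul]
  exact this

theorem lintegral_enorm_iteratedFDeriv_lt_top {K : E → ℝ} (hK : ContDiff ℝ ∞ K)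
    (hc : HasCompactSupport K) (l : ℕ) : ∫⁻ y, ‖iteratedFDeriv ℝ l K y‖ₑ < ⊤ :=
  ((hK.continuous_iteratedFDeriv (m := l) (by exact_mod_cast le_top)).integrable_of_hasCompactSupport
    (hc.iteratedFDeriv (𝕜 := ℝ) l)).2

theorem pieceCost_conv_dilate_le {K : E → ℝ} (hK : ContDiff ℝ ∞ K) (hc : HasCompactSupport K)
    (s : ℝ) (J : ℕ) {τ : ℝ} (hτ : 0 < τ) {g : E → ℝ} (hg : Integrable g volume) :
    pieceCost s J τ (conv g (dilate τ K)) ≤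
      (∑ l ∈ Finset.range (J + 1), ∫⁻ y, ‖iteratedFDeriv ℝ l K y‖ₑ) *
        (ENNReal.ofReal (τ ^ (-s)) * ∫⁻ x, ‖g x‖ₑ) := by
  rw [pieceCost, Finset.sum_mul]
  refine Finset.sum_le_sum fun l _ => ?_
  have hd := contDiff_dilate τ hK
  rw [iteratedFDeriv_conv hg.locallyIntegrable hd (hasCompactSupport_dilate hτ hc)]
  refine (mul_le_mul_right (lintegral_enorm_conv_le hg.1
    (hd.continuous_iteratedFDeriv (m := l) (by exact_mod_cast le_top))) _).trans (le_of_eq ?_)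
  rw [lintegral_enorm_iteratedFDeriv_dilate hK hτ, ← mul_assoc, ← mul_assoc,
    ← ENNReal.ofReal_mul (by positivity)]
  have e : τ ^ ((l : ℝ) - s) * τ⁻¹ ^ l = τ ^ (-s) := by
    rw [sub_eq_add_neg, Real.rpow_add hτ, Real.rpow_natCast, inv_pow]
    field_simp
  rw [e]
  ring

/-- If the approximations `f * K_τ`, `τ = 2^{-k}`, converge to `f` in `L¹` fast enough, then `f` is the
sum of smooth pieces of summable cost. The `k`-th partial sum is `f * K_τ * K_{τ/2}`; since convolutions
commute, the `(k+1)`-st piece is the convolution with `K_{τ/2}`, which takes all derivatives, of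
the difference of two approximations. -/
theorem exists_pieces_of_approximation {K : E → ℝ} (hK : ContDiff ℝ ∞ K) (hc : HasCompactSupport K)
    {s : ℝ} (hs : 0 ≤ s) (J : ℕ) :
    ∃ C : ℝ≥0, ∀ f : E → ℝ, Integrable f volume →
      ∑' k : ℕ, ENNReal.ofReal (((1 / 2 : ℝ) ^ k) ^ (-s)) *
        ∫⁻ x, ‖f x - conv f (dilate ((1 / 2 : ℝ) ^ k) K) x‖ₑ < ⊤ →
      ∃ u : ℕ → E → ℝ, (∀ k, ContDiff ℝ ∞ (u k)) ∧
        Tendsto (fun N => ∫⁻ x, ‖f x - ∑ k ∈ Finset.range N, u k x‖ₑ) atTop (𝓝 0) ∧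
        ∑' k, pieceCost s J ((1 / 2 : ℝ) ^ k) (u k) ≤ C * ((∫⁻ x, ‖f x‖ₑ) +
          ∑' k : ℕ, ENNReal.ofReal (((1 / 2 : ℝ) ^ k) ^ (-s)) *
            ∫⁻ x, ‖f x - conv f (dilate ((1 / 2 : ℝ) ^ k) K) x‖ₑ) := by
  set A : ℝ≥0∞ := ∑ l ∈ Finset.range (J + 1), ∫⁻ y, ‖iteratedFDeriv ℝ l K y‖ₑ with hA
  have hAtop : A < ⊤ :=
    ENNReal.sum_lt_top.2 fun l _ => lintegral_enorm_iteratedFDeriv_lt_top hK hc l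
  set τ : ℕ → ℝ := fun k => (1 / 2 : ℝ) ^ k with hτdef
  have hτ : ∀ k, 0 < τ k := fun k => by positivity
  set b : ℝ≥0∞ := ENNReal.ofReal (2 ^ s) with hb
  have hbtop : b < ⊤ := ENNReal.ofReal_lt_top
  have hb1 : 1 ≤ b := by
    rw [hb, ← ENNReal.ofReal_one]
    exact ENNReal.ofReal_le_ofReal (Real.one_le_rpow (by norm_num) hs)
  set w : ℕ → ℝ≥0∞ := fun k => ENNReal.ofReal ((τ k) ^ (-s)) with hw
  have hw0 : w 0 = 1 := by simp [hw, hτdef]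
  have hwsucc : ∀ k, w (k + 1) = b * w k := by
    intro k
    simp only [hw, hb, hτdef]
    rw [← ENNReal.ofReal_mul (by positivity), pow_succ, Real.mul_rpow (by positivity) (by norm_num),
      mul_comm, one_div, Real.inv_rpow (by norm_num), Real.rpow_neg (by norm_num), inv_inv]
  have hwmono : ∀ k, w k ≤ w (k + 1) := fun k => by
    rw [hwsucc]; exact le_mul_of_one_le_left zero_le hb1
  have hw1 : ∀ k, 1 ≤ w k := by
    intro k
    induction k with
    | zero => exact hw0.ge
    | succ k ih => exact ih.trans (hwmono k)
  have hd : ∀ k, ContDiff ℝ ∞ (dilate (τ k) K) := fun k => contDiff_dilate _ hK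
  have hdc : ∀ k, HasCompactSupport (dilate (τ k) K) := fun k => hasCompactSupport_dilate (hτ k) hc
  have hA0 : ∀ k (g : E → ℝ), Integrable g volume →
      ∫⁻ x, ‖conv g (dilate (τ k) K) x‖ₑ ≤ A * ∫⁻ x, ‖g x‖ₑ := by
    intro k g hg
    refine (lintegral_enorm_conv_le hg.1 (hd k).continuous).trans (mul_le_mul_left ?_ _)
    have h0 := lintegral_enorm_iteratedFDeriv_dilate hK (hτ k) 0
    have e : ∀ (G : E → ℝ) (x : E), ‖iteratedFDeriv ℝ 0 G x‖ₑ = ‖G x‖ₑ := fun G x => by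
      rw [← ofReal_norm, ← ofReal_norm, norm_iteratedFDeriv_zero]
    rw [pow_zero, ENNReal.ofReal_one, one_mul] at h0
    simp_rw [e (dilate (τ k) K)] at h0
    rw [h0, hA]
    exact Finset.single_le_sum (f := fun l => ∫⁻ y, ‖iteratedFDeriv ℝ l K y‖ₑ)
      (fun _ _ => zero_le) (Finset.mem_range.2 (Nat.succ_pos J))
  refine ⟨(A * (A + 2 * b)).toNNReal, fun f hf hsum => ?_⟩
  rw [ENNReal.coe_toNNReal (ENNReal.mul_lt_top hAtop (ENNReal.add_lt_top.2
    ⟨hAtop, ENNReal.mul_lt_top (by norm_num) hbtop⟩)).ne]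
  set P : ℕ → E → ℝ := fun k => conv f (dilate (τ k) K) with hP
  have hPi : ∀ k, Integrable (P k) volume := fun k => integrable_conv hf (hd k).continuous (hdc k)
  set q : ℕ → ℝ≥0∞ := fun k => ∫⁻ x, ‖f x - P k x‖ₑ with hq
  change ∑' k, w k * q k < ⊤ at hsum
  let g : ℕ → E → ℝ := fun k => Nat.casesOn k (P 1) fun k x => P (k + 2) x - P k x
  have hg : ∀ k, Integrable (g k) volume := by
    rintro (_ | k)
    · exact hPi 1
    · exact (hPi (k + 2)).sub (hPi k)
  let u : ℕ → E → ℝ := fun k => conv (g k) (dilate (τ k) K)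
  have hU : ∀ N x, ∑ k ∈ Finset.range (N + 1), u k x = conv (P (N + 1)) (dilate (τ N) K) x := by
    intro N x
    induction N with
    | zero => simp [u, g]
    | succ N ih =>
      rw [Finset.sum_range_succ, ih]
      simp only [u, g]
      rw [conv_sub (hPi _) (hPi _) (hd _).continuous (hdc _)]
      have := congrFun (conv_comm hf (hd N).continuous (hdc N) (hd (N + 1)).continuous
        (hdc (N + 1))) x
      simp only [hP] at this ⊢
      rw [this]
      ring
  refine ⟨u, fun k => contDiff_conv (hg k).locallyIntegrable (hd k) (hdc k), ?_, ?_⟩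
  · rw [← tendsto_add_atTop_iff_nat 1]
    have hwq := ENNReal.tendsto_atTop_zero_of_tsum_ne_top hsum.ne
    have hq0 : Tendsto q atTop (𝓝 0) := tendsto_of_tendsto_of_tendsto_of_le_of_le
      tendsto_const_nhds hwq (fun _ => zero_le) (fun k => le_mul_of_one_le_left zero_le (hw1 k))
    have hlim : Tendsto (fun N => q N + A * q (N + 1)) atTop (𝓝 0) := by
      have := hq0.add (ENNReal.Tendsto.const_mul (hq0.comp (tendsto_add_atTop_nat 1))
        (Or.inr hAtop.ne))
      simpa using this
    refine tendsto_of_tendsto_of_tendsto_of_le_of_le tendsto_const_nhds hlim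
      (fun _ => zero_le) (fun N => ?_)
    have e : ∀ x, f x - ∑ k ∈ Finset.range (N + 1), u k x =
        (f x - P N x) + conv (fun x => f x - P (N + 1) x) (dilate (τ N) K) x := by
      intro x
      rw [hU, conv_sub hf (hPi _) (hd _).continuous (hdc _)]
      ring
    simp only [e]
    exact (lintegral_enorm_add_le (hf.sub (hPi N)).1).trans
      (add_le_add_right (hA0 N _ (hf.sub (hPi _))) _)
  · have hcost : ∀ k, pieceCost s J (τ k) (u k) ≤ A * (w k * ∫⁻ x, ‖g k x‖ₑ) := fun k =>
      pieceCost_conv_dilate_le hK hc s J (hτ k) (hg k)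
    have hg0 : ∫⁻ x, ‖g 0 x‖ₑ ≤ A * ∫⁻ x, ‖f x‖ₑ := hA0 1 f hf
    have hgs : ∀ k, ∫⁻ x, ‖g (k + 1) x‖ₑ ≤ q k + q (k + 2) := by
      intro k
      have e : ∀ x, g (k + 1) x = (f x - P k x) - (f x - P (k + 2) x) := fun x => by
        simp only [g]; ring
      simp only [e]
      exact lintegral_enorm_sub_le (hf.sub (hPi k)).1
    calc ∑' k, pieceCost s J (τ k) (u k) ≤ ∑' k, A * (w k * ∫⁻ x, ‖g k x‖ₑ) :=
          ENNReal.tsum_le_tsum hcost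
      _ = A * (w 0 * (∫⁻ x, ‖g 0 x‖ₑ) + ∑' k, w (k + 1) * ∫⁻ x, ‖g (k + 1) x‖ₑ) := by
          rw [ENNReal.tsum_mul_left, tsum_eq_zero_add' ENNReal.summable]
      _ ≤ A * (A * (∫⁻ x, ‖f x‖ₑ) + (b * ∑' k, w k * q k + b * ∑' k, w k * q k)) := by
          refine mul_le_mul_right (add_le_add ?_ ?_) _
          · rw [hw0, one_mul]; exact hg0
          · calc ∑' k, w (k + 1) * ∫⁻ x, ‖g (k + 1) x‖ₑ
                ≤ ∑' k, (b * (w k * q k) + w (k + 2) * q (k + 2)) := by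
                  refine ENNReal.tsum_le_tsum fun k => ?_
                  refine (mul_le_mul_right (hgs k) _).trans ?_
                  rw [mul_add]
                  refine add_le_add ?_ (mul_le_mul_left (hwmono (k + 1)) _)
                  rw [hwsucc, mul_assoc]
              _ = b * (∑' k, w k * q k) + ∑' k, w (k + 2) * q (k + 2) := by
                  rw [ENNReal.tsum_add, ENNReal.tsum_mul_left]
              _ ≤ _ := by
                  refine add_le_add_right ?_ _
                  refine (ENNReal.tsum_comp_le_tsum_of_injective (add_left_injective 2)
                    fun k => w k * q k).trans ?_
                  exact le_mul_of_one_le_left zero_le hb1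
      _ ≤ A * (A + 2 * b) * ((∫⁻ x, ‖f x‖ₑ) + ∑' k, w k * q k) := by
          rw [mul_assoc]
          refine mul_le_mul_right ?_ _
          rw [← two_mul, ← mul_assoc, add_mul]
          exact add_le_add (mul_le_mul_right le_self_add _) (mul_le_mul_right le_add_self _)

end Telescoping

/-! ### The `L¹` modulus of smoothness -/

section Modulus

variable {E : Type*} [NormedAddCommGroup E] [NormedSpace ℝ E] [FiniteDimensional ℝ E]
  [MeasureSpace E] [BorelSpace E] [(volume : Measure E).IsAddHaarMeasure]

/-- The norm `‖Δ_h^M f‖_{L¹}` of the `M`-th difference with step `h`. -/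
noncomputable def modulus (M : ℕ) (f : E → ℝ) (h : E) : ℝ≥0∞ := ∫⁻ x, ‖(fwdDiff h)^[M] f x‖ₑ

theorem fwdDiff_iter_eq_sum (M : ℕ) (f : E → ℝ) (h x : E) :
    (fwdDiff h)^[M] f x = ∑ k ∈ Finset.range (M + 1),
      ((-1) ^ (M - k) * (M.choose k : ℝ)) * f (x + (k : ℝ) • h) := by
  rw [fwdDiff_iter_eq_sum_shift]
  refine Finset.sum_congr rfl fun k _ => ?_
  rw [zsmul_eq_mul, Nat.cast_smul_eq_nsmul]
  push_cast
  rfl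

theorem fwdDiff_iter_ae_eq (M : ℕ) {f g : E → ℝ} (hfg : f =ᵐ[volume] g) (h : E) :
    (fwdDiff h)^[M] f =ᵐ[volume] (fwdDiff h)^[M] g := by
  have hk : ∀ᵐ x, ∀ k : ℕ, f (x + (k : ℝ) • h) = g (x + (k : ℝ) • h) :=
    ae_all_iff.2 fun k =>
      (measurePreserving_add_right volume ((k : ℝ) • h)).quasiMeasurePreserving.ae_eq_comp hfg
  filter_upwards [hk] with x hx
  simp only [fwdDiff_iter_eq_sum, hx]

theorem modulus_congr (M : ℕ) {f g : E → ℝ} (hfg : f =ᵐ[volume] g) : modulus M f = modulus M g := by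
  funext h
  refine lintegral_congr_ae ?_
  filter_upwards [fwdDiff_iter_ae_eq M hfg h] with x hx
  rw [hx]

theorem measurable_uncurry_fwdDiff_iter (M : ℕ) {f : E → ℝ} (hf : Measurable f) :
    Measurable fun p : E × E => (fwdDiff p.1)^[M] f p.2 := by
  simp only [fwdDiff_iter_eq_sum]
  refine Finset.measurable_fun_sum _ fun k _ => (hf.comp ?_).const_mul _
  exact measurable_snd.add (measurable_fst.const_smul (k : ℝ))

theorem measurable_modulus (M : ℕ) {f : E → ℝ} (hf : AEStronglyMeasurable f volume) :
    Measurable (modulus M f) := by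
  rw [modulus_congr M hf.ae_eq_mk]
  exact (measurable_uncurry_fwdDiff_iter M hf.stronglyMeasurable_mk.measurable).enorm.lintegral_prod_right'

/-! ### Approximation by averages of differences -/

/-- A smooth even probability density supported in the unit ball. -/
theorem exists_even_mollifier : ∃ ρ : E → ℝ, ContDiff ℝ ∞ ρ ∧ HasCompactSupport ρ ∧
    (∀ x, ρ (-x) = ρ x) ∧ ∫ x, ρ x = 1 ∧ ∀ x, 1 ≤ ‖x‖ → ρ x = 0 := by
  let φ : ContDiffBump (0 : E) := ⟨1 / 2, 1, by norm_num, by norm_num⟩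
  refine ⟨φ.normed volume, φ.contDiff_normed, φ.hasCompactSupport_normed, φ.normed_neg,
    φ.integral_normed, fun x hx => ?_⟩
  rw [← Function.notMem_support, φ.support_normed_eq]
  simpa using hx

/-- The kernel `∑_{k=1}^{M} (-1)^{k+1} (M choose k) ρ_k`, for which `f - f * K` is, up to a sign,
the average `∫ Δ_h^M f ρ(h) dh`. -/
noncomputable def diffKernel (M : ℕ) (ρ : E → ℝ) (y : E) : ℝ :=
  ∑ k ∈ Finset.range M, ((-1) ^ k * (M.choose (k + 1) : ℝ)) * dilate ((k : ℝ) + 1) ρ y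

theorem contDiff_diffKernel (M : ℕ) {ρ : E → ℝ} (hρ : ContDiff ℝ ∞ ρ) :
    ContDiff ℝ ∞ (diffKernel M ρ) :=
  ContDiff.sum fun _ _ => contDiff_const.mul (contDiff_dilate _ hρ)

theorem hasCompactSupport_diffKernel (M : ℕ) {ρ : E → ℝ} (hρ : HasCompactSupport ρ) :
    HasCompactSupport (diffKernel M ρ) := by
  have : diffKernel M ρ = ∑ k ∈ Finset.range M,
      fun y => ((-1) ^ k * (M.choose (k + 1) : ℝ)) * dilate ((k : ℝ) + 1) ρ y := by
    funext y; simp [diffKernel]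
  rw [this]
  exact Finset.sum_induction _ HasCompactSupport (fun _ _ => HasCompactSupport.add)
    HasCompactSupport.zero fun k _ =>
      (hasCompactSupport_dilate (by positivity) hρ).mul_left

theorem integrable_comp_add_smul_mul {f ρ : E → ℝ} (hf : Integrable f volume) (hρ : Continuous ρ)
    (hc : HasCompactSupport ρ) (x : E) (r : ℝ) :
    Integrable (fun h => f (x + r • h) * ρ h) volume := by
  rcases eq_or_ne r 0 with rfl | hr
  · simpa using (hρ.integrable_of_hasCompactSupport hc).const_mul (f x)
  · have h1 : Integrable (fun h => f (x + r • h)) volume := (hf.comp_add_left x).comp_smul hr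
    exact h1.locallyIntegrable.integrable_smul_right_of_hasCompactSupport hρ hc

theorem sub_conv_diffKernel {f ρ : E → ℝ} (hf : Integrable f volume) (hρ : Continuous ρ)
    (hc : HasCompactSupport ρ) (heven : ∀ x, ρ (-x) = ρ x) (hint : ∫ x, ρ x = 1) (M : ℕ) {r : ℝ}
    (hr : 0 < r) (x : E) :
    f x - conv f (dilate r (diffKernel M ρ)) x =
      (-1) ^ M * ∫ h, (fwdDiff (r • h))^[M] f x * ρ h := by
  have hconv : conv f (dilate r (diffKernel M ρ)) x = ∑ k ∈ Finset.range M,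
      ((-1) ^ k * (M.choose (k + 1) : ℝ)) * ∫ h, f (x + (((k : ℝ) + 1) * r) • h) * ρ h := by
    rw [conv_dilate_apply _ _ hr]
    simp only [diffKernel, Finset.mul_sum]
    rw [integral_finsetSum]
    · refine Finset.sum_congr rfl fun k _ => ?_
      simp only [mul_left_comm (f _)]
      rw [integral_const_mul, integral_mul_dilate (fun y => f (x - r • y)) ρ (by positivity),
        ← integral_neg_eq_self]
      congr 2
      funext h
      rw [heven, smul_neg, smul_neg, sub_neg_eq_add, smul_smul, mul_comm r]
    · intro k _
      simp only [mul_left_comm (f _)]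
      refine Integrable.const_mul ?_ _
      have hcont : Continuous (dilate ((k : ℝ) + 1) ρ) :=
        continuous_const.mul (hρ.comp (continuous_const_smul _))
      have := integrable_comp_add_smul_mul hf hcont
        (hasCompactSupport_dilate (by positivity) hc) x (-r)
      simpa only [neg_smul, ← sub_eq_add_neg] using this
  have hdiff : ∫ h, (fwdDiff (r • h))^[M] f x * ρ h = ∑ k ∈ Finset.range (M + 1),
      ((-1) ^ (M - k) * (M.choose k : ℝ)) * ∫ h, f (x + ((k : ℝ) * r) • h) * ρ h := by
    simp only [fwdDiff_iter_eq_sum, Finset.sum_mul, smul_smul, mul_assoc (_ * _ : ℝ) (f _)]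
    rw [integral_finsetSum]
    · exact Finset.sum_congr rfl fun k _ => integral_const_mul _ _
    · exact fun k _ => (integrable_comp_add_smul_mul hf hρ hc x ((k : ℝ) * r)).const_mul _
  rw [hconv, hdiff, Finset.sum_range_succ', mul_add, Finset.mul_sum, sub_eq_add_neg, add_comm,
    ← Finset.sum_neg_distrib]
  congr 1
  · refine Finset.sum_congr rfl fun k hk => ?_
    have hk' := Finset.mem_range.1 hk
    have hsign : (-1 : ℝ) ^ M * (-1) ^ (M - (k + 1)) = -(-1) ^ k := by
      rw [← pow_add, show M + (M - (k + 1)) = 2 * (M - (k + 1)) + (k + 1) by omega, pow_add,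
        pow_mul, neg_one_sq, one_pow, pow_succ]
      ring
    rw [← mul_assoc, ← mul_assoc, hsign]
    push_cast
    ring
  · simp [integral_const_mul, hint, ← mul_assoc, ← mul_pow]

theorem lintegral_enorm_sub_conv_diffKernel_le {f ρ : E → ℝ} (hfm : Measurable f)
    (hf : Integrable f volume) (hρ : Continuous ρ)
    (hc : HasCompactSupport ρ) (heven : ∀ x, ρ (-x) = ρ x) (hint : ∫ x, ρ x = 1) (M : ℕ) {r : ℝ}
    (hr : 0 < r) :
    ∫⁻ x, ‖f x - conv f (dilate r (diffKernel M ρ)) x‖ₑ ≤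
      ∫⁻ h, modulus M f (r • h) * ‖ρ h‖ₑ := by
  have hm : Measurable fun p : E × E => ‖(fwdDiff (r • p.2))^[M] f p.1 * ρ p.2‖ₑ :=
    (((measurable_uncurry_fwdDiff_iter M hfm).comp
      ((measurable_snd.const_smul r).prodMk measurable_fst)).mul
      (hρ.measurable.comp measurable_snd)).enorm
  calc ∫⁻ x, ‖f x - conv f (dilate r (diffKernel M ρ)) x‖ₑ
      ≤ ∫⁻ x, ∫⁻ h, ‖(fwdDiff (r • h))^[M] f x * ρ h‖ₑ := by
        refine lintegral_mono fun x => ?_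
        rw [sub_conv_diffKernel hf hρ hc heven hint M hr, enorm_mul]
        have h1 : ‖(-1 : ℝ) ^ M‖ₑ = 1 := by
          rw [← ofReal_norm, norm_pow, norm_neg, norm_one, one_pow, ENNReal.ofReal_one]
        rw [h1, one_mul]
        exact enorm_integral_le_lintegral_enorm _
    _ = ∫⁻ h, ∫⁻ x, ‖(fwdDiff (r • h))^[M] f x * ρ h‖ₑ := lintegral_lintegral_swap hm.aemeasurable
    _ = _ := by
        refine lintegral_congr fun h => ?_
        simp_rw [enorm_mul]
        rw [lintegral_mul_const' _ _ enorm_ne_top]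
        rfl

/-- `∑ 2^{kp}` over the `k` with `2^k ≤ X` is of the order of `X^p`. -/
theorem exists_sum_dyadic_le {p : ℝ} (hp : 0 < p) : ∃ C : ℝ, 0 ≤ C ∧ ∀ X : ℝ, 0 ≤ X → ∀ N : ℕ,
    ∑ k ∈ Finset.range N, (if (2 : ℝ) ^ k ≤ X then ((2 : ℝ) ^ k) ^ p else 0) ≤ C * X ^ p := by
  have hb : 1 < (2 : ℝ) ^ p := Real.one_lt_rpow (by norm_num) hp
  have hb' : 0 < (2 : ℝ) ^ p - 1 := by linarith
  refine ⟨(2 : ℝ) ^ p / ((2 : ℝ) ^ p - 1), by positivity, fun X hX N => ?_⟩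
  have hpow : ∀ k : ℕ, ((2 : ℝ) ^ k) ^ p = ((2 : ℝ) ^ p) ^ k := fun k => by
    rw [← Real.rpow_natCast, ← Real.rpow_natCast, ← Real.rpow_mul (by norm_num),
      ← Real.rpow_mul (by norm_num), mul_comm]
  induction N with
  | zero => simp; positivity
  | succ N ih =>
    by_cases h : (2 : ℝ) ^ N ≤ X
    · calc ∑ k ∈ Finset.range (N + 1), (if (2 : ℝ) ^ k ≤ X then ((2 : ℝ) ^ k) ^ p else 0)
          ≤ ∑ k ∈ Finset.range (N + 1), ((2 : ℝ) ^ p) ^ k := by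
            refine Finset.sum_le_sum fun k _ => ?_
            rw [hpow]
            split_ifs
            · exact le_rfl
            · positivity
        _ = (((2 : ℝ) ^ p) ^ (N + 1) - 1) / ((2 : ℝ) ^ p - 1) := geom_sum_eq hb.ne' _
        _ ≤ ((2 : ℝ) ^ p) ^ (N + 1) / ((2 : ℝ) ^ p - 1) := by gcongr; linarith
        _ = (2 : ℝ) ^ p / ((2 : ℝ) ^ p - 1) * ((2 : ℝ) ^ N) ^ p := by rw [hpow]; ring
        _ ≤ _ := by gcongr
    · rw [Finset.sum_range_succ, if_neg h, add_zero]
      exact ih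

theorem exists_tsum_approximation_le [Nontrivial E] {ρ : E → ℝ} (hρ : Continuous ρ)
    (hc : HasCompactSupport ρ) (heven : ∀ x, ρ (-x) = ρ x) (hint : ∫ x, ρ x = 1)
    (hball : ∀ x, 1 ≤ ‖x‖ → ρ x = 0) {s : ℝ} (hs : 0 < s) (M : ℕ) :
    ∃ C : ℝ≥0, ∀ f : E → ℝ, Measurable f → Integrable f volume →
      ∑' k : ℕ, ENNReal.ofReal (((1 / 2 : ℝ) ^ k) ^ (-s)) *
        ∫⁻ x, ‖f x - conv f (dilate ((1 / 2 : ℝ) ^ k) (diffKernel M ρ)) x‖ₑ ≤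
      C * ∫⁻ h, modulus M f h / ENNReal.ofReal (‖h‖ ^ ((Module.finrank ℝ E : ℝ) + s)) := by
  set d := Module.finrank ℝ E with hd
  obtain ⟨B, hB⟩ := hc.exists_bound_of_continuous hρ
  have hB0 : 0 ≤ B := (norm_nonneg _).trans (hB 0)
  have hp : 0 < (d : ℝ) + s := by positivity
  obtain ⟨D, hD0, hD⟩ := exists_sum_dyadic_le hp
  refine ⟨(B * D).toNNReal, fun f hfm hf => ?_⟩
  have hmod := measurable_modulus M hf.1
  let T : ℕ → E → ℝ≥0∞ := fun k h => ENNReal.ofReal (((1 / 2 : ℝ) ^ k) ^ (-s)) *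
    (ENNReal.ofReal (((1 / 2 : ℝ) ^ k) ^ d)⁻¹ * (modulus M f h * ‖ρ (((1 / 2 : ℝ) ^ k)⁻¹ • h)‖ₑ))
  have hTm : ∀ k, Measurable (T k) := fun k =>
    ((hmod.mul (hρ.enorm.measurable.comp (measurable_const_smul _))).const_mul _).const_mul _
  have hT : ∀ k, T k = fun h => modulus M f h * ENNReal.ofReal (((2 : ℝ) ^ k) ^ ((d : ℝ) + s) *
      ‖ρ ((2 : ℝ) ^ k • h)‖) := by
    intro k
    funext h
    simp only [T]
    have e1 : ((1 / 2 : ℝ) ^ k)⁻¹ = 2 ^ k := by rw [one_div, inv_pow, inv_inv]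
    have e2 : ((1 / 2 : ℝ) ^ k) ^ (-s) * (((1 / 2 : ℝ) ^ k) ^ d)⁻¹ =
        ((2 : ℝ) ^ k) ^ ((d : ℝ) + s) := by
      rw [← inv_pow, e1, Real.rpow_neg (by positivity), ← Real.inv_rpow (by positivity), e1,
        Real.rpow_add (by positivity), Real.rpow_natCast, mul_comm]
    rw [e1, ← mul_assoc, ← ENNReal.ofReal_mul (by positivity), e2,
      ENNReal.ofReal_mul (by positivity), ofReal_norm]
    ring
  calc ∑' k : ℕ, ENNReal.ofReal (((1 / 2 : ℝ) ^ k) ^ (-s)) *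
        ∫⁻ x, ‖f x - conv f (dilate ((1 / 2 : ℝ) ^ k) (diffKernel M ρ)) x‖ₑ
      ≤ ∑' k : ℕ, ∫⁻ h, T k h := by
        refine ENNReal.tsum_le_tsum fun k => ?_
        have hk : 0 < (1 / 2 : ℝ) ^ k := by positivity
        have h1 := lintegral_enorm_sub_conv_diffKernel_le hfm hf hρ hc heven hint M hk
        rw [lintegral_mul_comp_smul hmod hρ.enorm.measurable hk] at h1
        refine (mul_le_mul_right h1 _).trans (le_of_eq ?_)
        simp only [T]
        rw [lintegral_const_mul' _ _ ENNReal.ofReal_ne_top,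
          lintegral_const_mul' _ _ ENNReal.ofReal_ne_top,
          lintegral_const_mul' _ _ ENNReal.ofReal_ne_top]
    _ = ∫⁻ h, ∑' k : ℕ, T k h := (lintegral_tsum fun k => (hTm k).aemeasurable).symm
    _ ≤ ∫⁻ h, ENNReal.ofReal (B * D) *
          (modulus M f h / ENNReal.ofReal (‖h‖ ^ ((d : ℝ) + s))) := by
        refine lintegral_mono_ae ?_
        -- The point `h = 0`, where the quotient has a junk value, is a null set.
        filter_upwards [compl_mem_ae_iff.2 (measure_singleton (0 : E))] with h hh
        have hh0 : 0 < ‖h‖ := norm_pos_iff.2 hh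
        simp only [hT]
        rw [ENNReal.tsum_mul_left, mul_comm (ENNReal.ofReal (B * D)), div_eq_mul_inv, mul_assoc]
        refine mul_le_mul_right ?_ _
        rw [← ENNReal.ofReal_inv_of_pos (by positivity), ← ENNReal.ofReal_mul (by positivity)]
        refine ENNReal.tsum_le_of_sum_range_le fun N => ?_
        rw [← ENNReal.ofReal_sum_of_nonneg fun k _ => by positivity]
        refine ENNReal.ofReal_le_ofReal ?_
        calc ∑ k ∈ Finset.range N, ((2 : ℝ) ^ k) ^ ((d : ℝ) + s) * ‖ρ ((2 : ℝ) ^ k • h)‖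
            ≤ ∑ k ∈ Finset.range N,
                (if (2 : ℝ) ^ k ≤ ‖h‖⁻¹ then ((2 : ℝ) ^ k) ^ ((d : ℝ) + s) else 0) * B := by
              refine Finset.sum_le_sum fun k _ => ?_
              split_ifs with hk
              · gcongr
                exact hB _
              · rw [hball, norm_zero, mul_zero, zero_mul]
                rw [norm_smul, Real.norm_of_nonneg (by positivity)]
                have := (not_le.1 hk).le
                rwa [inv_le_iff_one_le_mul₀ hh0] at this
          _ ≤ D * (‖h‖⁻¹) ^ ((d : ℝ) + s) * B := by
              rw [← Finset.sum_mul]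
              gcongr
              exact hD _ (by positivity) N
          _ = (‖h‖ ^ ((d : ℝ) + s))⁻¹ * (B * D) := by
              rw [Real.inv_rpow hh0.le]; ring
          _ ≤ _ := by rw [mul_comm]
    _ = _ := by
        rw [lintegral_const_mul' _ _ ENNReal.ofReal_ne_top]
        rfl

/-- A function with finite Besov modulus is the `L¹` sum of smooth pieces of summable cost. -/
theorem exists_pieces_of_modulus [Nontrivial E] {s : ℝ} (hs : 0 < s) (M J : ℕ) :
    ∃ C : ℝ≥0, ∀ f : E → ℝ, Integrable f volume →
      ∫⁻ h, modulus M f h / ENNReal.ofReal (‖h‖ ^ ((Module.finrank ℝ E : ℝ) + s)) < ⊤ →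
      ∃ u : ℕ → E → ℝ, (∀ k, ContDiff ℝ ∞ (u k)) ∧
        Tendsto (fun N => ∫⁻ x, ‖f x - ∑ k ∈ Finset.range N, u k x‖ₑ) atTop (𝓝 0) ∧
        ∑' k, pieceCost s J ((1 / 2 : ℝ) ^ k) (u k) ≤ C * ((∫⁻ x, ‖f x‖ₑ) +
          ∫⁻ h, modulus M f h / ENNReal.ofReal (‖h‖ ^ ((Module.finrank ℝ E : ℝ) + s))) := by
  obtain ⟨ρ, hρ, hc, heven, hint, hball⟩ := exists_even_mollifier (E := E)
  obtain ⟨C₁, h₁⟩ := exists_tsum_approximation_le hρ.continuous hc heven hint hball hs M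
  obtain ⟨C₂, h₂⟩ := exists_pieces_of_approximation (contDiff_diffKernel M hρ)
    (hasCompactSupport_diffKernel M hc) hs.le J
  refine ⟨C₂ * (1 + C₁), fun f hf hfin => ?_⟩
  set g := hf.1.mk f with hg
  have hfg : f =ᵐ[volume] g := hf.1.ae_eq_mk
  have hgi : Integrable g volume := hf.congr hfg
  rw [modulus_congr M hfg] at hfin ⊢
  have h3 := h₁ g hf.1.stronglyMeasurable_mk.measurable hgi
  obtain ⟨u, hu, hlim, hcost⟩ := h₂ g hgi (h3.trans_lt (ENNReal.mul_lt_top ENNReal.coe_lt_top hfin))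
  refine ⟨u, hu, ?_, ?_⟩
  · refine hlim.congr fun N => lintegral_congr_ae ?_
    filter_upwards [hfg] with x hx
    rw [hx]
  · have hn : ∫⁻ x, ‖f x‖ₑ = ∫⁻ x, ‖g x‖ₑ := by
      refine lintegral_congr_ae ?_
      filter_upwards [hfg] with x hx
      rw [hx]
    rw [hn]
    refine hcost.trans ?_
    rw [ENNReal.coe_mul, mul_assoc]
    refine mul_le_mul_right ?_ _
    rw [ENNReal.coe_add, ENNReal.coe_one, add_mul, one_mul]
    refine add_le_add le_self_add (h3.trans ?_)
    rw [mul_add]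
    exact le_add_self

end Modulus

/-! ### Differences and derivatives -/

section Differences

variable {E : Type*} [NormedAddCommGroup E] [NormedSpace ℝ E] [FiniteDimensional ℝ E]
  [MeasureSpace E] [BorelSpace E] [(volume : Measure E).IsAddHaarMeasure]

theorem contDiff_fwdDiff_iter {g : E → ℝ} (hg : ContDiff ℝ ∞ g) (M : ℕ) (h : E) :
    ContDiff ℝ ∞ ((fwdDiff h)^[M] g) := by
  rw [funext (fwdDiff_iter_eq_sum M g h)]
  exact ContDiff.sum fun k _ => contDiff_const.mul (hg.comp (contDiff_id.add contDiff_const))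

theorem iteratedFDeriv_fwdDiff_iter_apply {g : E → ℝ} (hg : ContDiff ℝ ∞ g) (M : ℕ) (h : E) {j : ℕ}
    (v : Fin j → E) (x : E) : iteratedFDeriv ℝ j ((fwdDiff h)^[M] g) x v =
      (fwdDiff h)^[M] (fun y => iteratedFDeriv ℝ j g y v) x := by
  have hs : ∀ k : ℕ, ContDiff ℝ ∞ (fun y => g (y + (k : ℝ) • h)) := fun k =>
    hg.comp (contDiff_id.add contDiff_const)
  have hs' : ∀ k : ℕ, ContDiffAt ℝ j (fun y => g (y + (k : ℝ) • h)) x := fun k =>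
    ((hs k).of_le (by exact_mod_cast le_top)).contDiffAt
  rw [funext (fwdDiff_iter_eq_sum M g h), fwdDiff_iter_eq_sum]
  simp only [← smul_eq_mul (a := (-1 : ℝ) ^ _ * _)]
  rw [iteratedFDeriv_fun_sum_apply fun k _ => (hs' k).const_smul _, _root_.sum_apply]
  refine Finset.sum_congr rfl fun k _ => ?_
  rw [iteratedFDeriv_const_smul_apply' (hs' k), iteratedFDeriv_comp_add_right']
  rfl

theorem lintegral_enorm_fwdDiff_le {g : E → ℝ} (hg : ContDiff ℝ ∞ g) (h : E) :
    ∫⁻ x, ‖fwdDiff h g x‖ₑ ≤ ∫⁻ x, ‖fderiv ℝ g x h‖ₑ := by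
  have hc : Continuous fun x => fderiv ℝ g x h := (contDiff_fderiv_apply_const hg h).continuous
  have hpt : ∀ x, ‖fwdDiff h g x‖ₑ ≤ ∫⁻ t in Ioc (0 : ℝ) 1, ‖fderiv ℝ g (x + t • h) h‖ₑ := by
    intro x
    have hline : ∀ t : ℝ, HasDerivAt (fun t : ℝ => g (x + t • h)) (fderiv ℝ g (x + t • h) h) t := by
      intro t
      have h1 : HasDerivAt (fun t : ℝ => x + t • h) h t := by
        simpa using ((hasDerivAt_id t).smul_const h).const_add x
      exact ((hg.differentiable (by simp) _).hasFDerivAt).comp_hasDerivAt t h1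
    have hcl : Continuous fun t : ℝ => fderiv ℝ g (x + t • h) h :=
      hc.comp (continuous_const.add (continuous_id.smul continuous_const))
    have hftc := intervalIntegral.integral_eq_sub_of_hasDerivAt (fun t _ => hline t)
      (hcl.intervalIntegrable 0 1)
    rw [one_smul, zero_smul, add_zero] at hftc
    rw [fwdDiff, ← hftc, intervalIntegral.integral_of_le zero_le_one]
    exact enorm_integral_le_lintegral_enorm _
  have hm : Measurable fun p : E × ℝ => ‖fderiv ℝ g (p.1 + p.2 • h) h‖ₑ :=
    (hc.comp (continuous_fst.add (continuous_snd.smul continuous_const))).enorm.measurable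
  calc ∫⁻ x, ‖fwdDiff h g x‖ₑ
      ≤ ∫⁻ x, ∫⁻ t in Ioc (0 : ℝ) 1, ‖fderiv ℝ g (x + t • h) h‖ₑ := lintegral_mono hpt
    _ = ∫⁻ t in Ioc (0 : ℝ) 1, ∫⁻ x, ‖fderiv ℝ g (x + t • h) h‖ₑ :=
        lintegral_lintegral_swap hm.aemeasurable
    _ = ∫⁻ t in Ioc (0 : ℝ) 1, ∫⁻ x, ‖fderiv ℝ g x h‖ₑ := by
        refine lintegral_congr fun t => ?_
        exact lintegral_add_right_eq_self (fun x => ‖fderiv ℝ g x h‖ₑ) (t • h)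
    _ = _ := by simp

theorem lintegral_enorm_fwdDiff_iter_le {g : E → ℝ} (hg : ContDiff ℝ ∞ g) (h : E) (l : ℕ) :
    ∫⁻ x, ‖(fwdDiff h)^[l] g x‖ₑ ≤ ∫⁻ x, ‖iteratedFDeriv ℝ l g x (fun _ => h)‖ₑ := by
  induction l generalizing g with
  | zero => simp
  | succ l ih =>
    have e : ∀ x, fderiv ℝ ((fwdDiff h)^[l] g) x h =
        (fwdDiff h)^[l] (fun y => fderiv ℝ g y h) x := by
      intro x
      have := iteratedFDeriv_fwdDiff_iter_apply hg l h (fun _ : Fin 1 => h) x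
      simpa only [iteratedFDeriv_one_apply] using this
    rw [Function.iterate_succ_apply']
    refine (lintegral_enorm_fwdDiff_le (contDiff_fwdDiff_iter hg l h) h).trans ?_
    simp only [e]
    refine (ih (contDiff_fderiv_apply_const hg h)).trans (le_of_eq ?_)
    refine lintegral_congr fun x => ?_
    rw [iteratedFDeriv_succ_apply_last hg]
    rfl

theorem fwdDiff_iter_conv {g K : E → ℝ} (hg : LocallyIntegrable g volume) (hK : Continuous K)
    (hc : HasCompactSupport K) (p : ℕ) (h : E) :
    (fwdDiff h)^[p] (conv g K) = conv ((fwdDiff h)^[p] g) K := by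
  funext x
  have hKx : Continuous fun y => K (x - y) := hK.comp (continuous_const.sub continuous_id)
  have hKc : HasCompactSupport fun y => K (x - y) := hc.comp_homeomorph (Homeomorph.subLeft x)
  have htr : ∀ a : E, conv g K (x + a) = ∫ y, g (y + a) * K (x - y) := by
    intro a
    rw [conv_apply, ← integral_add_right_eq_self (fun y => g y • K (x + a - y)) a]
    simp only [smul_eq_mul, add_sub_add_right_eq_sub]
  have hi : ∀ a : E, Integrable (fun y => g (y + a) * K (x - y)) volume := by
    intro a
    have hl : LocallyIntegrable (fun y => g (y + a)) volume := by
      intro y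
      obtain ⟨U, hU, hUi⟩ := hg (y + a)
      refine ⟨(fun z => z + a) ⁻¹' U, (continuous_add_const a).continuousAt.preimage_mem_nhds hU, ?_⟩
      exact ((measurePreserving_add_right volume a).integrableOn_comp_preimage
        (MeasurableEquiv.addRight a).measurableEmbedding).2 hUi
    exact hl.integrable_smul_right_of_hasCompactSupport hKx hKc
  rw [fwdDiff_iter_eq_sum, conv_apply]
  simp only [fwdDiff_iter_eq_sum, smul_eq_mul, Finset.sum_mul, mul_assoc (_ * _ : ℝ) (g _)]
  rw [integral_finsetSum]
  · refine Finset.sum_congr rfl fun k _ => ?_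
    rw [integral_const_mul, htr]
  · exact fun k _ => (hi _).const_mul _

theorem aestronglyMeasurable_fwdDiff_iter {g : E → ℝ} (hg : AEStronglyMeasurable g volume) (p : ℕ)
    (h : E) : AEStronglyMeasurable ((fwdDiff h)^[p] g) volume := by
  refine AEStronglyMeasurable.congr ?_ (fwdDiff_iter_ae_eq p hg.ae_eq_mk h).symm
  exact ((measurable_uncurry_fwdDiff_iter p hg.stronglyMeasurable_mk.measurable).comp
    measurable_prodMk_left).aestronglyMeasurable

theorem modulus_conv_le {f g K : E → ℝ} {l : ℕ} {h : E}
    (hfg : HasWeakDeriv univ (fun _ : Fin l => h) f g) (hK : ContDiff ℝ ∞ K)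
    (hc : HasCompactSupport K) (p : ℕ) :
    modulus (l + p) (conv f K) h ≤ (∫⁻ x, ‖K x‖ₑ) * modulus p g h := by
  have hf' : LocallyIntegrable f volume := locallyIntegrableOn_univ.1 hfg.1
  have hg' : LocallyIntegrable g volume := locallyIntegrableOn_univ.1 hfg.2.1
  have hs := contDiff_conv hf' hK hc
  calc modulus (l + p) (conv f K) h
      = ∫⁻ x, ‖(fwdDiff h)^[l] ((fwdDiff h)^[p] (conv f K)) x‖ₑ := by
        rw [modulus, Function.iterate_add_apply]
    _ ≤ ∫⁻ x, ‖iteratedFDeriv ℝ l ((fwdDiff h)^[p] (conv f K)) x (fun _ => h)‖ₑ :=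
        lintegral_enorm_fwdDiff_iter_le (contDiff_fwdDiff_iter hs p h) h l
    _ = ∫⁻ x, ‖conv ((fwdDiff h)^[p] g) K x‖ₑ := by
        refine lintegral_congr fun x => ?_
        rw [iteratedFDeriv_fwdDiff_iter_apply hs, funext (hfg.iteratedFDeriv_conv hK hc),
          fwdDiff_iter_conv hg' hK.continuous hc]
    _ ≤ _ := lintegral_enorm_conv_le
        (aestronglyMeasurable_fwdDiff_iter hg'.aestronglyMeasurable p h) hK.continuous

/-- `‖Δ_h^{l+p} f‖_{L¹} ≤ ‖Δ_h^p g‖_{L¹}`, where `g` is the weak derivative of `f` in the direction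
`(h, …, h)`. For the mollifications of `f` this is the mean value theorem, and the bound passes
to the limit by Fatou's lemma. -/
theorem modulus_le_of_hasWeakDeriv {f g : E → ℝ} {l : ℕ} {h : E}
    (hfg : HasWeakDeriv univ (fun _ : Fin l => h) f g) (p : ℕ) :
    modulus (l + p) f h ≤ modulus p g h := by
  have hf' : LocallyIntegrable f volume := locallyIntegrableOn_univ.1 hfg.1
  let φ : ℕ → ContDiffBump (0 : E) := fun i =>
    ⟨1 / ((i : ℝ) + 1) / 2, 1 / ((i : ℝ) + 1), by positivity, half_lt_self (by positivity)⟩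
  let K : ℕ → E → ℝ := fun i => (φ i).normed volume
  have hK1 : ∀ i, ∫⁻ x, ‖K i x‖ₑ = 1 := by
    intro i
    rw [← ENNReal.ofReal_one, ← (φ i).integral_normed (μ := volume),
      ofReal_integral_eq_lintegral_ofReal (φ i).integrable_normed
        (Eventually.of_forall fun x => (φ i).nonneg_normed x)]
    exact lintegral_congr fun x => Real.enorm_of_nonneg ((φ i).nonneg_normed x)
  have hlim : ∀ᵐ x, Tendsto (fun i => conv f (K i) x) atTop (𝓝 (f x)) := by
    have h0 : Tendsto (fun i => (φ i).rOut) atTop (𝓝 0) := tendsto_one_div_add_atTop_nhds_zero_nat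
    have := ContDiffBump.ae_convolution_tendsto_right_of_locallyIntegrable (K := 2) h0
      (Eventually.of_forall fun i => by simp [φ]; linarith) hf'
    filter_upwards [this] with x hx
    refine hx.congr fun i => ?_
    rw [conv, convolution_lsmul_swap, convolution_lsmul]
    simp only [smul_eq_mul, mul_comm, K]
  have hlim' : ∀ᵐ x, Tendsto (fun i => (fwdDiff h)^[l + p] (conv f (K i)) x) atTop
      (𝓝 ((fwdDiff h)^[l + p] f x)) := by
    have hk : ∀ᵐ x, ∀ k : ℕ, Tendsto (fun i => conv f (K i) (x + (k : ℝ) • h)) atTop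
        (𝓝 (f (x + (k : ℝ) • h))) := ae_all_iff.2 fun k =>
      (measurePreserving_add_right volume ((k : ℝ) • h)).quasiMeasurePreserving.ae hlim
    filter_upwards [hk] with x hx
    simp only [fwdDiff_iter_eq_sum]
    exact tendsto_finsetSum _ fun k _ => (hx k).const_mul _
  calc modulus (l + p) f h
      ≤ ∫⁻ x, liminf (fun i => ‖(fwdDiff h)^[l + p] (conv f (K i)) x‖ₑ) atTop := by
        refine lintegral_mono_ae ?_
        filter_upwards [hlim'] with x hx
        exact hx.enorm.liminf_eq.ge
    _ ≤ liminf (fun i => ∫⁻ x, ‖(fwdDiff h)^[l + p] (conv f (K i)) x‖ₑ) atTop :=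
        lintegral_liminf_le fun i => (contDiff_fwdDiff_iter (contDiff_conv hf'
          ((φ i).contDiff_normed (μ := volume)) (φ i).hasCompactSupport_normed) _ h).continuous.enorm.measurable
    _ ≤ liminf (fun _ : ℕ => modulus p g h) atTop := by
        refine liminf_le_liminf (Eventually.of_forall fun i => ?_)
        have := modulus_conv_le hfg ((φ i).contDiff_normed (μ := volume)) (φ i).hasCompactSupport_normed p
        rw [hK1 i, one_mul] at this
        exact this
    _ = modulus p g h := liminf_const _

theorem modulus_sum_le {ι : Type*} (S : Finset ι) (c : ι → ℝ) (g : ι → E → ℝ)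
    (hg : ∀ i ∈ S, AEStronglyMeasurable (g i) volume) (p : ℕ) (h : E) :
    modulus p (fun x => ∑ i ∈ S, c i * g i x) h ≤ ∑ i ∈ S, ‖c i‖ₑ * modulus p (g i) h := by
  have e : ∀ x, (fwdDiff h)^[p] (fun x => ∑ i ∈ S, c i * g i x) x =
      ∑ i ∈ S, c i * (fwdDiff h)^[p] (g i) x := by
    intro x
    simp only [fwdDiff_iter_eq_sum, Finset.mul_sum]
    rw [Finset.sum_comm]
    refine Finset.sum_congr rfl fun i _ => Finset.sum_congr rfl fun k _ => by ring
  calc modulus p (fun x => ∑ i ∈ S, c i * g i x) h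
      ≤ ∫⁻ x, ∑ i ∈ S, ‖c i‖ₑ * ‖(fwdDiff h)^[p] (g i) x‖ₑ := by
        refine lintegral_mono fun x => ?_
        rw [e]
        refine (enorm_sum_le _ _).trans (le_of_eq ?_)
        simp_rw [enorm_mul]
    _ = _ := by
        rw [lintegral_finsetSum' S fun i hi =>
          ((aestronglyMeasurable_fwdDiff_iter (hg i hi) p h).enorm).const_mul _]
        refine Finset.sum_congr rfl fun i _ => ?_
        rw [lintegral_const_mul' _ _ enorm_ne_top]
        rfl

end Differences

/-! ### Besov norms -/

section Besov

variable {n : ℕ}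

theorem sum_smul_dir (h : EuclideanSpace ℝ (Fin n)) : ∑ i, h i • dir n i = h := by
  ext j
  simp [dir, Pi.single_apply]

/-- Sorting a word turns its weak derivative into that of a multi-index. -/
theorem hasWeakDeriv_partialDeriv_sort {l : ℕ} {f : EuclideanSpace ℝ (Fin n) → ℝ}
    (hf : MemSobolevLoc univ (dir n) l f) (w : Fin l → Fin n) :
    HasWeakDeriv univ (fun i => dir n (w i)) f (partialDeriv (w ∘ Tuple.sort w) f) := by
  have h := (hasWeakDeriv_weakDeriv (hf l le_rfl (w ∘ Tuple.sort w))).comp_perm (Tuple.sort w)⁻¹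
  have e : (fun i => dir n ((w ∘ Tuple.sort w) i)) ∘ ⇑(Tuple.sort w)⁻¹ = fun i => dir n (w i) := by
    funext i
    simp
  rw [e] at h
  exact h

theorem modulus_le_partialDeriv {l : ℕ} {f : EuclideanSpace ℝ (Fin n) → ℝ}
    (hf : MemSobolevLoc univ (dir n) l f) (p : ℕ) (h : EuclideanSpace ℝ (Fin n)) :
    modulus (l + p) f h ≤ ENNReal.ofReal ((n : ℝ) ^ l * ‖h‖ ^ l) *
      ∑ α ∈ multiIndices n l, modulus p (partialDeriv α f) h := by
  have hw := hasWeakDeriv_partialDeriv_sort hf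
  have hloc : LocallyIntegrableOn f univ volume :=
    (hf 0 (Nat.zero_le l) Fin.elim0).choose_spec.1
  have h1 := HasWeakDeriv.sum_smul hloc hw h
  rw [sum_smul_dir] at h1
  refine (modulus_le_of_hasWeakDeriv h1 p).trans ((modulus_sum_le _ _ _ (fun w _ =>
    (locallyIntegrableOn_univ.1 (hw w).2.1).aestronglyMeasurable) p h).trans ?_)
  have hterm : ∀ w : Fin l → Fin n, ‖∏ j, h (w j)‖ₑ *
      modulus p (partialDeriv (w ∘ Tuple.sort w) f) h ≤ ENNReal.ofReal (‖h‖ ^ l) *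
        ∑ α ∈ multiIndices n l, modulus p (partialDeriv α f) h := by
    intro w
    refine mul_le_mul' ?_ ?_
    · rw [← ofReal_norm, norm_prod]
      refine ENNReal.ofReal_le_ofReal ?_
      calc ∏ j, ‖h (w j)‖ ≤ ∏ _j : Fin l, ‖h‖ :=
            Finset.prod_le_prod (fun _ _ => norm_nonneg _) fun j _ => PiLp.norm_apply_le h (w j)
        _ = ‖h‖ ^ l := by simp
    · refine Finset.single_le_sum (f := fun α => modulus p (partialDeriv α f) h)
        (fun _ _ => zero_le) ?_
      simp only [multiIndices, Finset.mem_filter, Finset.mem_univ, true_and]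
      exact Tuple.monotone_sort w
  refine (Finset.sum_le_sum fun w _ => hterm w).trans (le_of_eq ?_)
  rw [Finset.sum_const, nsmul_eq_mul, ← mul_assoc]
  congr 1
  rw [ENNReal.ofReal_mul (by positivity)]
  simp [ENNReal.ofReal_pow]

theorem lintegral_enorm_le_sobolevNorm {l : ℕ} {f : EuclideanSpace ℝ (Fin n) → ℝ}
    (hf : LocallyIntegrable f volume) : ∫⁻ x, ‖f x‖ₑ ≤ sobolevNorm n l f := by
  let α : Fin 0 → Fin n := Fin.elim0
  have hα : α ∈ multiIndices n 0 := by
    simp only [multiIndices, Finset.mem_filter, Finset.mem_univ, true_and]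
    exact fun i => i.elim0
  have h0 := (hasWeakDeriv_zero (hf.locallyIntegrableOn univ)
    (fun i => dir n (α i))).weakDeriv_ae_eq isOpen_univ
  rw [Measure.restrict_univ] at h0
  calc ∫⁻ x, ‖f x‖ₑ = ∫⁻ x, ‖partialDeriv α f x‖ₑ := by
        refine lintegral_congr_ae ?_
        filter_upwards [h0] with x hx
        rw [partialDeriv, hx]
    _ ≤ ∑ α ∈ multiIndices n 0, ∫⁻ x, ‖partialDeriv α f x‖ₑ :=
        Finset.single_le_sum (f := fun α => ∫⁻ x, ‖partialDeriv α f x‖ₑ) (fun _ _ => zero_le) hα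
    _ ≤ _ := Finset.single_le_sum
        (f := fun j => ∑ α ∈ multiIndices n j, ∫⁻ x, ‖partialDeriv α f x‖ₑ)
        (fun _ _ => zero_le) (Finset.mem_range.2 (Nat.succ_pos l))

end Besov

section BesovModulus

variable {n : ℕ}

/-- The order of differences that matches smoothness `s`: `ℓ` derivatives are traded for differences, and
the seminorm of order `s - ℓ` takes `⌊s - ℓ⌋ + 1` more. -/
noncomputable def differenceOrder (s : ℝ) : ℕ := besovOrder s + (⌊s - besovOrder s⌋₊ + 1)

theorem lintegral_modulus_le_besovNorm [Nonempty (Fin n)] {s : ℝ}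
    {f : EuclideanSpace ℝ (Fin n) → ℝ} (hf : MemSobolevLoc univ (dir n) (besovOrder s) f) :
    ∫⁻ h, modulus (differenceOrder s) f h / ENNReal.ofReal (‖h‖ ^ ((n : ℝ) + s)) ≤
      ENNReal.ofReal ((n : ℝ) ^ besovOrder s) * besovNorm n s f := by
  set l := besovOrder s with hl
  set p := ⌊s - l⌋₊ + 1 with hp
  have hm : ∀ α ∈ multiIndices n l, Measurable fun h =>
      modulus p (partialDeriv α f) h / ENNReal.ofReal (‖h‖ ^ ((n : ℝ) + (s - l))) := by
    intro α _
    have h1 : LocallyIntegrableOn (partialDeriv α f) univ volume :=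
      (hasWeakDeriv_weakDeriv (hf l le_rfl α)).2.1
    exact (measurable_modulus p (locallyIntegrableOn_univ.1 h1).aestronglyMeasurable).div
      (by fun_prop)
  calc ∫⁻ h, modulus (differenceOrder s) f h / ENNReal.ofReal (‖h‖ ^ ((n : ℝ) + s))
      ≤ ∫⁻ h, ENNReal.ofReal ((n : ℝ) ^ l) * ∑ α ∈ multiIndices n l,
          modulus p (partialDeriv α f) h / ENNReal.ofReal (‖h‖ ^ ((n : ℝ) + (s - l))) := by
        refine lintegral_mono_ae ?_
        filter_upwards [compl_mem_ae_iff.2 (measure_singleton (0 : EuclideanSpace ℝ (Fin n)))]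
          with h hh
        have hh0 : 0 < ‖h‖ := norm_pos_iff.2 hh
        have e : ENNReal.ofReal ((n : ℝ) ^ l * ‖h‖ ^ l) / ENNReal.ofReal (‖h‖ ^ ((n : ℝ) + s)) =
            ENNReal.ofReal ((n : ℝ) ^ l) / ENNReal.ofReal (‖h‖ ^ ((n : ℝ) + (s - l))) := by
          rw [← ENNReal.ofReal_div_of_pos (by positivity),
            ← ENNReal.ofReal_div_of_pos (by positivity)]
          congr 1
          rw [show (n : ℝ) + s = ((n : ℝ) + (s - l)) + l by ring, Real.rpow_add hh0,
            Real.rpow_natCast]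
          have := (pow_pos hh0 l).ne'
          have := (Real.rpow_pos_of_pos hh0 ((n : ℝ) + (s - l))).ne'
          field_simp
        refine (ENNReal.div_le_div_right (modulus_le_partialDeriv hf p h) _).trans (le_of_eq ?_)
        simp only [div_eq_mul_inv] at e ⊢
        rw [mul_right_comm, e, mul_assoc, mul_comm (_⁻¹) (∑ _ ∈ _, _), Finset.sum_mul]
    _ = ENNReal.ofReal ((n : ℝ) ^ l) * ∑ α ∈ multiIndices n l,
          besovSeminorm n (s - l) (partialDeriv α f) := by
        rw [lintegral_const_mul' _ _ ENNReal.ofReal_ne_top, lintegral_finsetSum _ hm]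
        rfl
    _ ≤ _ := mul_le_mul_right le_add_self _

/-- A function in `B^{s,1}` is the `L¹` sum of smooth pieces of summable cost. -/
theorem exists_pieces_of_besov [Nonempty (Fin n)] {s : ℝ} (hs : 0 < s) (J : ℕ) :
    ∃ C : ℝ≥0, ∀ f : EuclideanSpace ℝ (Fin n) → ℝ, MemBesov n s f →
      ∃ u : ℕ → EuclideanSpace ℝ (Fin n) → ℝ, (∀ k, ContDiff ℝ ∞ (u k)) ∧
        Tendsto (fun N => ∫⁻ x, ‖f x - ∑ k ∈ Finset.range N, u k x‖ₑ) atTop (𝓝 0) ∧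
        ∑' k, pieceCost s J ((1 / 2 : ℝ) ^ k) (u k) ≤ C * besovNorm n s f := by
  obtain ⟨C, hC⟩ := exists_pieces_of_modulus (E := EuclideanSpace ℝ (Fin n)) hs
    (differenceOrder s) J
  rw [finrank_euclideanSpace_fin] at hC
  refine ⟨C * (1 + (n : ℝ≥0) ^ besovOrder s), fun f hf => ?_⟩
  have hloc : LocallyIntegrable f volume :=
    locallyIntegrableOn_univ.1 (hf.1 0 (Nat.zero_le _) Fin.elim0).choose_spec.1
  have hL1 : ∫⁻ x, ‖f x‖ₑ ≤ besovNorm n s f :=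
    (lintegral_enorm_le_sobolevNorm hloc).trans le_self_add
  have hmod := lintegral_modulus_le_besovNorm hf.1
  obtain ⟨u, hu, hlim, hcost⟩ := hC f ⟨hloc.aestronglyMeasurable, hL1.trans_lt hf.2⟩
    (hmod.trans_lt (ENNReal.mul_lt_top ENNReal.ofReal_lt_top hf.2))
  refine ⟨u, hu, hlim, hcost.trans ?_⟩
  rw [ENNReal.coe_mul, mul_assoc]
  refine mul_le_mul_right ?_ _
  rw [ENNReal.coe_add, ENNReal.coe_one, add_mul, one_mul]
  refine add_le_add hL1 (hmod.trans (le_of_eq ?_))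
  congr 1
  rw [ENNReal.ofReal_pow (by positivity), ENNReal.ofReal_natCast]
  simp

end BesovModulus

/-! ### Decomposition of an integrable function -/

section Integrable

variable {E : Type*} [NormedAddCommGroup E] [NormedSpace ℝ E] [FiniteDimensional ℝ E]
  [MeasureSpace E] [BorelSpace E] [(volume : Measure E).IsAddHaarMeasure]

/-- For smoothness `0` only the term without derivatives is not small at small scales. -/
theorem exists_scale_pieceCost_le {u : E → ℝ} (hu : ContDiff ℝ ∞ u) (hc : HasCompactSupport u)
    (J : ℕ) {ε : ℝ≥0∞} (hε : ε ≠ 0) {b : ℝ} (hb : 0 < b) :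
    ∃ τ : ℝ, 0 < τ ∧ τ ≤ 1 ∧ τ ≤ b ∧ pieceCost 0 J τ u ≤ (∫⁻ x, ‖u x‖ₑ) + ε := by
  let B : ℝ≥0∞ := ∑ l ∈ Finset.range J, ∫⁻ y, ‖iteratedFDeriv ℝ (l + 1) u y‖ₑ
  have hB : B < ⊤ := ENNReal.sum_lt_top.2 fun l _ => lintegral_enorm_iteratedFDeriv_lt_top hu hc _
  have hcost : ∀ τ : ℝ, 0 < τ → τ ≤ 1 → pieceCost 0 J τ u ≤
      (∫⁻ x, ‖u x‖ₑ) + ENNReal.ofReal τ * B := by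
    intro τ h0 h1
    rw [pieceCost, Finset.sum_range_succ', add_comm, Finset.mul_sum]
    refine add_le_add (le_of_eq ?_) (Finset.sum_le_sum fun l _ => ?_)
    · simp only [Nat.cast_zero, sub_zero, Real.rpow_zero, ENNReal.ofReal_one, one_mul]
      refine lintegral_congr fun x => ?_
      rw [← ofReal_norm, ← ofReal_norm, norm_iteratedFDeriv_zero]
    · rw [sub_zero, Real.rpow_natCast]
      refine mul_le_mul_left (ENNReal.ofReal_le_ofReal ?_) _
      exact pow_le_of_le_one h0.le h1 (Nat.succ_ne_zero l)
  have hlim : Tendsto (fun τ : ℝ => ENNReal.ofReal τ * B) (𝓝[>] 0) (𝓝 0) := by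
    have h1 : Tendsto (fun τ : ℝ => ENNReal.ofReal τ) (𝓝[>] 0) (𝓝 0) := by
      simpa using (ENNReal.continuous_ofReal.tendsto (0 : ℝ)).mono_left nhdsWithin_le_nhds
    simpa using ENNReal.Tendsto.mul_const h1 (Or.inr hB.ne)
  have hev : ∀ᶠ τ : ℝ in 𝓝[>] 0, 0 < τ ∧ τ ≤ 1 ∧ τ ≤ b ∧ ENNReal.ofReal τ * B ≤ ε := by
    filter_upwards [self_mem_nhdsWithin, nhdsWithin_le_nhds (Iic_mem_nhds one_pos),
      nhdsWithin_le_nhds (Iic_mem_nhds hb),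
      ENNReal.tendsto_nhds_zero.1 hlim ε (pos_iff_ne_zero.2 hε)] with τ h1 h2 h3 h4
    exact ⟨h1, h2, h3, h4⟩
  obtain ⟨τ, h0, h1, h2, h3⟩ := hev.exists
  exact ⟨τ, h0, h1, h2, (hcost τ h0 h1).trans (add_le_add_right h3 _)⟩

/-- An integrable function is the `L¹` sum of smooth pieces whose cost for smoothness `0`, at suitably
small scales, is at most a multiple of its norm. The scales depend on the function. -/
theorem exists_pieces_of_integrable (J : ℕ) {f : E → ℝ} (hf : Integrable f volume) :
    ∃ (τ : ℕ → ℝ) (u : ℕ → E → ℝ), (∀ k, 0 < τ k) ∧ (∀ k, τ k ≤ 1) ∧ Tendsto τ atTop (𝓝 0) ∧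
      (∀ k, ContDiff ℝ ∞ (u k)) ∧
      Tendsto (fun N => ∫⁻ x, ‖f x - ∑ k ∈ Finset.range N, u k x‖ₑ) atTop (𝓝 0) ∧
      ∑' k, pieceCost 0 J (τ k) (u k) ≤ 8 * ∫⁻ x, ‖f x‖ₑ := by
  set δ : ℝ≥0∞ := ∫⁻ x, ‖f x‖ₑ with hδ
  have hδtop : δ < ⊤ := hf.2
  rcases eq_or_ne δ 0 with h0 | h0
  · refine ⟨fun k => (1 / 2) ^ k, fun _ _ => 0, fun k => by positivity,
      fun k => pow_le_one₀ (by norm_num) (by norm_num),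
      tendsto_pow_atTop_nhds_zero_of_lt_one (by norm_num) (by norm_num),
      fun _ => contDiff_const, ?_, ?_⟩
    · simp [← hδ, h0]
    · have hz : ∀ (l : ℕ) (x : E), ‖iteratedFDeriv ℝ l (fun _ : E => (0 : ℝ)) x‖ₑ = 0 := by
        intro l x
        rw [← ofReal_norm, iteratedFDeriv_fun_zero]
        simp
      simp only [pieceCost, hz, lintegral_zero, mul_zero, Finset.sum_const_zero, tsum_zero]
      exact zero_le
  -- The `k`-th partial sum approximates `f` within `2⁻ᵏ ‖f‖`, so that the norms of the
  -- differences form a convergent geometric series bounded by a multiple of `‖f‖`.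
  let ε : ℕ → ℝ≥0∞ := fun k => 2⁻¹ ^ k * δ
  have hε : ∀ k, ε k ≠ 0 := fun k => mul_ne_zero (pow_ne_zero _ (by simp)) h0
  have hεtop : ∀ k, ε k ≠ ⊤ := fun k => ENNReal.mul_ne_top (by simp) hδtop.ne
  have hεanti : ∀ k, ε (k + 1) ≤ ε k := fun k => by
    simp only [ε]
    gcongr ?_ * δ
    rw [pow_succ]
    exact mul_le_of_le_one_right zero_le (by simp)
  have hεsum : ∑' k, ε k = 2 * δ := by
    rw [ENNReal.tsum_mul_right, ENNReal.tsum_geometric, ENNReal.one_sub_inv_two, inv_inv]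
  have happ : ∀ k, ∃ g : E → ℝ, HasCompactSupport g ∧ ContDiff ℝ ∞ g ∧
      ∫⁻ x, ‖f x - g x‖ₑ ≤ ε k := by
    intro k
    obtain ⟨g, hgc, hg, h⟩ := (memLp_one_iff_integrable.2 hf).exist_eLpNorm_sub_le
      ENNReal.one_ne_top le_rfl (ENNReal.toReal_pos (hε k) (hεtop k))
    rw [ENNReal.ofReal_toReal (hεtop k), eLpNorm_one_eq_lintegral_enorm] at h
    exact ⟨g, hgc, hg, h⟩
  choose g hgc hg hgε using happ
  let u : ℕ → E → ℝ := fun k => Nat.casesOn k (g 0) fun k x => g (k + 1) x - g k x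
  have hu : ∀ k, ContDiff ℝ ∞ (u k) := by
    rintro (_ | k)
    · exact hg 0
    · exact (hg (k + 1)).sub (hg k)
  have huc : ∀ k, HasCompactSupport (u k) := by
    rintro (_ | k)
    · exact hgc 0
    · exact (hgc (k + 1)).sub (hgc k)
  have hgi : ∀ k, Integrable (g k) volume := fun k =>
    (hg k).continuous.integrable_of_hasCompactSupport (hgc k)
  have hnorm : ∀ k, ∫⁻ x, ‖u k x‖ₑ ≤ 2 * ε (k - 1) := by
    rintro (_ | k)
    · have e : ∀ x, u 0 x = f x - (f x - g 0 x) := fun x => by simp [u]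
      simp only [e]
      refine (lintegral_enorm_sub_le hf.1).trans ?_
      rw [two_mul]
      exact add_le_add (by simp [ε, hδ]) (hgε 0)
    · have e : ∀ x, u (k + 1) x = (f x - g k x) - (f x - g (k + 1) x) := fun x => by simp [u]
      simp only [e]
      refine (lintegral_enorm_sub_le (hf.sub (hgi k)).1).trans ?_
      rw [two_mul]
      exact add_le_add (hgε k) ((hgε (k + 1)).trans (hεanti k))
  choose τ hτ0 hτ1 hτb hτ using fun k =>
    exists_scale_pieceCost_le (hu k) (huc k) J (hε k) (b := (1 / 2) ^ k) (by positivity)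
  have hpow : Tendsto (fun k : ℕ => (1 / 2 : ℝ) ^ k) atTop (𝓝 0) :=
    tendsto_pow_atTop_nhds_zero_of_lt_one (by norm_num) (by norm_num)
  refine ⟨τ, u, hτ0, hτ1, tendsto_of_tendsto_of_tendsto_of_le_of_le tendsto_const_nhds hpow
    (fun k => (hτ0 k).le) hτb, hu, ?_, ?_⟩
  · rw [← tendsto_add_atTop_iff_nat 1]
    have hsum : ∀ N x, ∑ k ∈ Finset.range (N + 1), u k x = g N x := by
      intro N x
      induction N with
      | zero => simp [u]
      | succ N ih => rw [Finset.sum_range_succ, ih]; simp [u]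
    simp only [hsum]
    have hε0 : Tendsto ε atTop (𝓝 0) := ENNReal.tendsto_atTop_zero_of_tsum_ne_top (by
      rw [hεsum]; exact ENNReal.mul_ne_top (by simp) hδtop.ne)
    exact tendsto_of_tendsto_of_tendsto_of_le_of_le tendsto_const_nhds hε0
      (fun _ => zero_le) hgε
  · have hshift : ∑' k, ε (k - 1) = 3 * δ := by
      rw [tsum_eq_zero_add' ENNReal.summable]
      simp only [Nat.add_sub_cancel, hεsum]
      simp only [ε, Nat.zero_sub, pow_zero, one_mul]
      ring
    calc ∑' k, pieceCost 0 J (τ k) (u k) ≤ ∑' k, (2 * ε (k - 1) + ε k) :=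
          ENNReal.tsum_le_tsum fun k => (hτ k).trans (add_le_add_left (hnorm k) _)
      _ = 8 * δ := by
          rw [ENNReal.tsum_add, ENNReal.tsum_mul_left, hεsum, hshift]
          ring

end Integrable

end TraceExt

theorem theorem1p3 (n : ℕ) (hn : 1 ≤ n) (m : ℕ) (a : ℝ) (ha : -1 < a) (ham : a ≤ m) :
    (a < m → ∃ C : ℝ≥0, ∀ f : EuclideanSpace ℝ (Fin n) → ℝ, TraceExt.MemBesov n (m - a) f →
      ∃ F : EuclideanSpace ℝ (Fin n) × ℝ → ℝ,
        TraceExt.MemWeighted n a (m + 1) F ∧ TraceExt.IsTrace n F f ∧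
          TraceExt.weightedNorm n a (m + 1) F ≤ C * TraceExt.besovNorm n (m - a) f) ∧
    (a = m → ∃ C : ℝ≥0, ∀ f : EuclideanSpace ℝ (Fin n) → ℝ, Integrable f volume →
      ∃ F : EuclideanSpace ℝ (Fin n) × ℝ → ℝ,
        TraceExt.MemWeighted n m (m + 1) F ∧ TraceExt.IsTrace n F f ∧
          TraceExt.weightedNorm n m (m + 1) F ≤ C * ∫⁻ x, ‖f x‖ₑ) := by
  have : Nonempty (Fin n) := ⟨⟨0, hn⟩⟩
  obtain ⟨C, hC⟩ := TraceExt.exists_extension_of_pieces n m ha ham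
  refine ⟨fun h => ?_, ?_⟩
  · obtain ⟨D, hD⟩ := TraceExt.exists_pieces_of_besov (n := n) (sub_pos.2 h) (m + 1)
    refine ⟨C * D, fun f hf => ?_⟩
    obtain ⟨u, hu, hlim, hcost⟩ := hD f hf
    obtain ⟨F, hF, htr, hle⟩ := hC (fun k => (1 / 2) ^ k) u f (fun k => by positivity)
      (fun k => pow_le_one₀ (by norm_num) (by norm_num))
      (tendsto_pow_atTop_nhds_zero_of_lt_one (by norm_num) (by norm_num)) hu hlim
      (hcost.trans_lt (ENNReal.mul_lt_top ENNReal.coe_lt_top hf.2))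
    refine ⟨F, hF, htr, hle.trans ?_⟩
    rw [ENNReal.coe_mul, mul_assoc]
    exact mul_le_mul_right hcost _
  · rintro rfl
    refine ⟨C * 8, fun f hf => ?_⟩
    obtain ⟨τ, u, hτ0, hτ1, hτ, hu, hlim, hcost⟩ :=
      TraceExt.exists_pieces_of_integrable (m + 1) hf
    rw [sub_self] at hC
    obtain ⟨F, hF, htr, hle⟩ := hC τ u f hτ0 hτ1 hτ hu hlim
      (hcost.trans_lt (ENNReal.mul_lt_top (by norm_num) hf.2))
    refine ⟨F, hF, htr, hle.trans ?_⟩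
    rw [ENNReal.coe_mul, mul_assoc]
    exact mul_le_mul_right hcost _
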